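/- \textbf{Left Adjoint Theorem.} Let $R$ be a ring. Let $\mathrm{Mod}(R)$ be the category of right $R$-modules, $\mathrm{mod}(R^{op})$ the category of finitely presented left $R$-modules, and $(\mathrm{mod}(R^{op}),\mathrm{Ab})$ the category of additive functors $\mathrm{mod}(R^{op})\to\mathrm{Ab}$. Let $\mathrm{fp}(\mathrm{Mod}(R),\mathrm{Ab})$ be the category of finitely presented functors, i.e. additive functors $F:\mathrm{Mod}(R)\to\mathrm{Ab}$ for which there are modules $X,Y$ and natural transformations $(Y,-)\to(X,-)\to F\to 0$ that form an exact sequence at every module; here $(X,-)=\mathrm{Hom}_R(X,-)$. Both functor categories are abelian, $\mathrm{fp}(\mathrm{Mod}(R),\mathrm{Ab})$ has enough projectives and $(\mathrm{mod}(R^{op}),\mathrm{Ab})$ has enough injectives. Let $\mathsf Y(X)=(X,-)$ be the contravariant Yoneda embedding $\mathrm{Mod}(R)\to\mathrm{fp}(\mathrm{Mod}(R),\mathrm{Ab})$, let $w$ be its contravariant adjoint, $\mathrm{Nat}(F,(X,-))\cong\mathrm{Hom}_R(X,wF)$, let $t(X)=X\otimes_R-$ be the tensor embedding $\mathrm{Mod}(R)\to(\mathrm{mod}(R^{op}),\mathrm{Ab})$,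 and let $\mathrm{ev}_R(G)=G(R)$, a right $R$-module. The Auslander--Gruson--Jensen functor is the contravariant functor $\mathsf D_A=R_0(t\circ w):\mathrm{fp}(\mathrm{Mod}(R),\mathrm{Ab})\to(\mathrm{mod}(R^{op}),\mathrm{Ab})$, the zeroth right derived functor of the contravariant functor $t\circ w$ (computed from projective resolutions). Let $\mathsf D_L=L^0(\mathsf Y\circ\mathrm{ev}_R):(\mathrm{mod}(R^{op}),\mathrm{Ab})\to\mathrm{fp}(\mathrm{Mod}(R),\mathrm{Ab})$ be the zeroth left derived functor of the contravariant functor $\mathsf Y\circ\mathrm{ev}_R$ (computed from injective resolutions). For a right module $X$ let $\gamma_{(X,-)}$ be the composite $$\mathsf D_L\mathsf D_A(X,-)\cong\mathsf D_L(X\otimes_R-)\to(X\otimes_R R,-)\cong(X,-),$$ whose middle map is the canonical morphism $L^0(\mathsf Y\circ\mathrm{ev}_R)\to\mathsf Y\circ\mathrm{ev}_R$ at $X\otimes_R-$. Then: (1) $\mathsf D_A$ is an exact contravariant functor. (2) $\mathsf D_L$ is fully faithful. (3) There is exactly one natural transformation $\gamma:\mathsf D_L\mathsf D_A\to 1$ on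 $\mathrm{fp}(\mathrm{Mod}(R),\mathrm{Ab})$ whose components at the representable functors are the above $\gamma_{(X,-)}$. (4) $\mathsf D_L$ is left adjoint to $\mathsf D_A$, when they are viewed as covariant functors $\mathsf D_L:(\mathrm{mod}(R^{op}),\mathrm{Ab})^{op}\to\mathrm{fp}(\mathrm{Mod}(R),\mathrm{Ab})$ and $\mathsf D_A:\mathrm{fp}(\mathrm{Mod}(R),\mathrm{Ab})\to(\mathrm{mod}(R^{op}),\mathrm{Ab})^{op}$, by an adjunction with counit $\gamma$ whose unit $\mathsf D_A\mathsf D_L\cong 1$ is an isomorphism. Its adjunction bijections are isomorphisms of abelian groups $\mathrm{Nat}(\mathsf D_LG,F)\cong\mathrm{Nat}(\mathsf D_AF,G)$, natural in $F\in\mathrm{fp}(\mathrm{Mod}(R),\mathrm{Ab})$ and $G\in(\mathrm{mod}(R^{op}),\mathrm{Ab})$. -/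

import Mathlib

open CategoryTheory Limits Opposite

universe u

namespace AGJ

/-! ### Additive functors with values in abelian groups form an abelian category -/

section AdditiveFunctors

universe v w

variable {C : Type w} [Category.{v} C] [Preadditive C]

instance : (additiveFunctor C AddCommGrpCat.{u}).IsClosedUnderSubobjects where
  prop_of_mono {F G} i _ hG := by
    have : G.Additive := hG
    have hi : ∀ A, Function.Injective (i.app A) := fun A =>
      (AddCommGrpCat.mono_iff_injective _).1 ((NatTrans.mono_iff_mono_app i).1 inferInstance A)
    refine ⟨fun {A B f g} => ?_⟩
    ext x
    apply hi
    have h := fun k : A ⟶ B => ConcreteCategory.congr_hom (i.naturality k) x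
    simp only [AddCommGrpCat.comp_apply] at h
    rw [h, G.map_add, AddCommGrpCat.hom_add_apply, AddCommGrpCat.hom_add_apply, map_add, h, h]

instance : (additiveFunctor C AddCommGrpCat.{u}).IsClosedUnderQuotients where
  prop_of_epi {F G} p _ hF := by
    have : F.Additive := hF
    have hp : ∀ A, Function.Surjective (p.app A) := fun A =>
      (AddCommGrpCat.epi_iff_surjective _).1 ((NatTrans.epi_iff_epi_app p).1 inferInstance A)
    refine ⟨fun {A B f g} => ?_⟩
    ext x
    obtain ⟨y, rfl⟩ := hp A x
    have h := fun k : A ⟶ B => ConcreteCategory.congr_hom (p.naturality k) y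
    simp only [AddCommGrpCat.comp_apply] at h
    rw [← h, F.map_add, AddCommGrpCat.hom_add_apply, AddCommGrpCat.hom_add_apply, map_add, h, h]

instance (J : Type) : (additiveFunctor C AddCommGrpCat.{u}).IsClosedUnderLimitsOfShape
    (Discrete J) where
  limitsOfShape_le := by
    rintro X ⟨p⟩
    refine ⟨fun {A B f g} => ?_⟩
    have hl := isLimitOfPreserves ((CategoryTheory.evaluation C AddCommGrpCat.{u}).obj B)
      p.isLimit
    refine hl.hom_ext fun j => ?_
    have : (p.diag.obj j).Additive := p.prop_diag_obj j
    have h := fun k : A ⟶ B => (p.π.app j).naturality k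
    dsimp at h ⊢
    rw [h, Preadditive.add_comp, h, h, Functor.map_add, Preadditive.comp_add]

instance : (additiveFunctor C AddCommGrpCat.{u}).ContainsZero where
  exists_zero := by
    obtain ⟨Z, hZ⟩ := HasZeroObject.zero (C := C ⥤ AddCommGrpCat.{u})
    exact ⟨Z, hZ, ⟨fun {A B f g} => ((Functor.isZero_iff _).1 hZ A).eq_of_src _ _⟩⟩

instance : (additiveFunctor C AddCommGrpCat.{u}).IsClosedUnderFiniteProducts where


end AdditiveFunctors

/-! ### Modules and functor categories -/

variable (R : Type u) [Ring R]

/-- `Mod(R)`: right `R`-modules, i.e. modules over the opposite ring. -/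
abbrev RMod : Type (u + 1) := ModuleCat.{u} Rᵐᵒᵖ

/-- Finite presentation, as a property of left `R`-modules. -/
def isFinPres : ObjectProperty (ModuleCat.{u} R) := fun L => Module.FinitePresentation R L

/-- `mod(Rᵒᵖ)`: finitely presented left `R`-modules. -/
abbrev FPLMod : Type (u + 1) := (isFinPres R).FullSubcategory

/-- `(mod(Rᵒᵖ), Ab)`: additive functors from `mod(Rᵒᵖ)` to abelian groups. -/
abbrev LFun : Type (u + 1) := FPLMod R ⥤+ AddCommGrpCat.{u}

/-- A functor `F : Mod(R) ⥤ Ab` is finitely presented if it is additive and there is a sequence of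
natural transformations `(Y, -) ⟶ (X, -) ⟶ F ⟶ 0` which is exact at every module. -/
def isFinPresFunctor : ObjectProperty (RMod R ⥤ AddCommGrpCat.{u}) := fun F =>
  F.Additive ∧ ∃ (X Y : RMod R) (φ : preadditiveCoyoneda.obj (op Y) ⟶ preadditiveCoyoneda.obj (op X))
    (π : preadditiveCoyoneda.obj (op X) ⟶ F), ∀ A : RMod R,
      Function.Exact (φ.app A) (π.app A) ∧ Function.Surjective (π.app A)

/-- `fp(Mod(R), Ab)`: finitely presented functors and natural transformations. -/
abbrev FPFun : Type (u + 1) := (isFinPresFunctor R).FullSubcategory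

/-! ### `(mod(Rᵒᵖ), Ab)` has enough injectives -/

section EnoughInjectives

variable {R}

/-- A small family of finitely presented left modules meeting every isomorphism class. -/
def Idx (R : Type u) [Ring R] : Type u :=
  {p : Σ n : ℕ, Submodule R (Fin n → R) // Module.FinitePresentation R ((Fin p.1 → R) ⧸ p.2)}

/-- The module with a given index. -/
def Idx.mod (t : Idx R) : FPLMod R := ⟨ModuleCat.of R ((Fin t.1.1 → R) ⧸ t.1.2), t.2⟩

lemma Idx.exists_iso (L : FPLMod R) : ∃ t : Idx R, Nonempty (L ≅ t.mod) := by
  have hL : Module.FinitePresentation R L.obj := L.property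
  obtain ⟨n, f, hf⟩ := Module.Finite.exists_fin' R L.obj
  let e := (f.quotKerEquivOfSurjective hf).symm
  have : Module.FinitePresentation R ((Fin n → R) ⧸ LinearMap.ker f) :=
    Module.FinitePresentation.of_equiv e
  exact ⟨⟨⟨n, LinearMap.ker f⟩, this⟩,
    ⟨(ObjectProperty.fullyFaithfulι _).preimageIso e.toModuleIso⟩⟩

/-- The functor `L' ↦ ∏ₜ Hom(Hom(L', Lₜ), Dₜ)`. -/
def cofree (D : Idx R → AddCommGrpCat.{u}) : FPLMod R ⥤ AddCommGrpCat.{u} where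
  obj L := AddCommGrpCat.of (∀ t : Idx R, (L ⟶ t.mod) →+ D t)
  map {L L'} h := AddCommGrpCat.ofHom
    { toFun := fun x t => (x t).comp
        { toFun := fun f => h ≫ f, map_zero' := by simp, map_add' := by simp }
      map_zero' := by ext; rfl
      map_add' := fun _ _ => by ext; rfl }
  map_id L := by ext x t f; simp
  map_comp f g := by ext x t f; simp

instance (D : Idx R → AddCommGrpCat.{u}) : (cofree D).Additive where
  map_add {L L' f g} := by
    ext x
    funext t
    ext k
    exact (congrArg (x t) (Preadditive.add_comp _ _ _ f g k)).trans ((x t).map_add _ _)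

/-- Maps into `cofree D` from compatible families of homomorphisms. -/
def toCofree (D : Idx R → AddCommGrpCat.{u}) (G : LFun R) (ψ : ∀ t, G.obj.obj t.mod ⟶ D t) :
    G ⟶ AdditiveFunctor.of (cofree D) :=
  ObjectProperty.homMk
    { app := fun L => AddCommGrpCat.ofHom
        { toFun := fun x t =>
            { toFun := fun f => ψ t (G.obj.map f x)
              map_zero' := by simp
              map_add' := fun f g => by simp [G.obj.map_add] }
          map_zero' := by ext; simp
          map_add' := fun _ _ => by ext; simp }
      naturality := fun L L' h => by
        ext x
        funext t
        ext f
        exact congrArg (ψ t) (ConcreteCategory.congr_hom (G.obj.map_comp h f) x).symm }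

lemma injective_app {G H : LFun R} (i : G ⟶ H) [Mono i] (A : FPLMod R) :
    Function.Injective (i.hom.app A) := by
  have : (ObjectProperty.ι (additiveFunctor (FPLMod R) AddCommGrpCat.{u})).PreservesMonomorphisms :=
    ObjectProperty.preservesMonomorphisms_ι_of_isNormalEpiCategory _
  have : Mono i.hom :=
    inferInstanceAs (Mono ((ObjectProperty.ι _).map i))
  exact (AddCommGrpCat.mono_iff_injective _).1 ((NatTrans.mono_iff_mono_app i.hom).1 this A)

instance (D : Idx R → AddCommGrpCat.{u}) [∀ t, Injective (D t)] :
    Injective (AdditiveFunctor.of (cofree D) : LFun R) where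
  factors {G H} g i _ := by
    have : ∀ t : Idx R, Mono (i.hom.app t.mod) := fun t =>
      (AddCommGrpCat.mono_iff_injective _).2 (injective_app i t.mod)
    let ev : ∀ t : Idx R, (cofree D).obj t.mod ⟶ D t := fun t => AddCommGrpCat.ofHom
      { toFun := fun x => x t (𝟙 _), map_zero' := rfl, map_add' := fun _ _ => rfl }
    refine ⟨toCofree D H fun t => Injective.factorThru (g.hom.app t.mod ≫ ev t)
      (i.hom.app t.mod), ?_⟩
    ext L x
    funext t
    ext f
    have h1 := ConcreteCategory.congr_hom (i.hom.naturality f) x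
    have h2 := ConcreteCategory.congr_hom (g.hom.naturality f) x
    have h3 := ConcreteCategory.congr_hom (Injective.comp_factorThru (g.hom.app t.mod ≫ ev t)
      (i.hom.app t.mod)) (G.obj.map f x)
    simp only [AddCommGrpCat.comp_apply] at h1 h2
    change Injective.factorThru (g.hom.app t.mod ≫ ev t) (i.hom.app t.mod)
      (H.obj.map f (i.hom.app L x)) = g.hom.app L x t f
    rw [← h1]
    refine h3.trans ((congrArg (ev t) h2).trans ?_)
    exact congrArg (DFunLike.coe (F := (L ⟶ t.mod) →+ D t) ((g.hom.app L x :
      ∀ t : Idx R, (L ⟶ t.mod) →+ D t) t)) (Category.comp_id f)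

instance : EnoughInjectives (LFun R) where
  presentation G := by
    let D : Idx R → AddCommGrpCat.{u} := fun t => Injective.under (G.obj.obj t.mod)
    let j := toCofree D G fun t => Injective.ι _
    have : Mono ((ObjectProperty.ι _).map j) := by
      refine (NatTrans.mono_iff_mono_app _).2 fun L => (AddCommGrpCat.mono_iff_injective _).2 ?_
      rw [injective_iff_map_eq_zero]
      intro x hx
      obtain ⟨t, ⟨e⟩⟩ := Idx.exists_iso L
      have h1 : Injective.ι (G.obj.obj t.mod) (G.obj.map e.hom x) = 0 :=
        DFunLike.congr_fun (congrFun hx t) e.hom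
      have h2 : G.obj.map e.hom x = 0 :=
        (injective_iff_map_eq_zero _).1 ((AddCommGrpCat.mono_iff_injective
          (Injective.ι (G.obj.obj t.mod))).1 inferInstance) _ h1
      have h3 : G.obj.map e.inv (G.obj.map e.hom x) = x := by
        rw [← AddCommGrpCat.comp_apply, ← Functor.map_comp]; simp
      rw [← h3, h2, map_zero]
    have : Mono j := (ObjectProperty.ι _).mono_of_mono_map this
    exact ⟨⟨_, inferInstance, j, inferInstance⟩⟩

end EnoughInjectives

/-! ### `fp(Mod(R), Ab)` is abelian with enough projectives -/

section FinitelyPresentedFunctors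

variable {R}

lemma map_zero_apply (F : RMod R ⥤ AddCommGrpCat.{u}) [F.Additive] {X Y : RMod R}
    (x : F.obj X) : F.map (0 : X ⟶ Y) x = 0 := by
  rw [F.map_zero]; rfl

lemma map_add_apply (F : RMod R ⥤ AddCommGrpCat.{u}) [F.Additive] {X Y : RMod R}
    (f g : X ⟶ Y) (x : F.obj X) : F.map (f + g) x = F.map f x + F.map g x := by
  rw [F.map_add]; rfl

/-- The natural transformation `(X, -) ⟶ F` corresponding to an element of `F(X)`. -/
def ofElem (F : RMod R ⥤ AddCommGrpCat.{u}) [F.Additive] {X : RMod R} (e : F.obj X) :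
    preadditiveCoyoneda.obj (op X) ⟶ F where
  app A := AddCommGrpCat.ofHom
    { toFun := fun g => F.map g e
      map_zero' := map_zero_apply F e
      map_add' := fun f g => map_add_apply F f g e }
  naturality A B h := by
    ext g
    exact ConcreteCategory.congr_hom (F.map_comp g h) e

lemma ofElem_apply (F : RMod R ⥤ AddCommGrpCat.{u}) [F.Additive] {X : RMod R} (e : F.obj X)
    {A : RMod R} (g : X ⟶ A) : (ofElem F e).app A g = F.map g e := rfl

lemma map_comp_apply (F : RMod R ⥤ AddCommGrpCat.{u}) {X Y Z : RMod R} (f : X ⟶ Y) (g : Y ⟶ Z)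
    (x : F.obj X) : F.map (f ≫ g) x = F.map g (F.map f x) :=
  ConcreteCategory.congr_hom (F.map_comp f g) x

lemma nat_apply {F G : RMod R ⥤ AddCommGrpCat.{u}} (α : F ⟶ G) {X Y : RMod R} (f : X ⟶ Y)
    (x : F.obj X) : α.app Y (F.map f x) = G.map f (α.app X x) :=
  ConcreteCategory.congr_hom (α.naturality f) x

/-- `e ∈ F(X)` generates `F`, with relations `f : X ⟶ Y`. -/
structure Presents (F : RMod R ⥤ AddCommGrpCat.{u}) {X Y : RMod R} (f : X ⟶ Y)
    (e : F.obj X) : Prop where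
  gen : ∀ {A : RMod R} (a : F.obj A), ∃ g : X ⟶ A, F.map g e = a
  rel : ∀ {A : RMod R} (g : X ⟶ A), F.map g e = 0 ↔ ∃ h : Y ⟶ A, g = f ≫ h

lemma isFinPresFunctor_iff (F : RMod R ⥤ AddCommGrpCat.{u}) : isFinPresFunctor R F ↔
    F.Additive ∧ ∃ (X Y : RMod R) (f : X ⟶ Y) (e : F.obj X), Presents F f e := by
  refine and_congr_right fun hF => ⟨?_, ?_⟩
  · rintro ⟨X, Y, φ, π, h⟩
    have hπ : ∀ {A : RMod R} (g : X ⟶ A), F.map g (π.app X (𝟙 X)) = π.app A g := fun {A} g => by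
      exact (nat_apply π g (𝟙 X)).symm.trans (congrArg (π.app A) (Category.id_comp g))
    have hφ : ∀ {A : RMod R} (g : Y ⟶ A), φ.app A g = (φ.app Y (𝟙 Y) : X ⟶ Y) ≫ g :=
      fun {A} g => by
        refine (congrArg (φ.app A) (Category.id_comp g).symm).trans ?_
        exact nat_apply φ g (𝟙 Y)
    refine ⟨X, Y, φ.app Y (𝟙 Y), π.app X (𝟙 X), ⟨fun {A} a => ?_, fun {A} g => ?_⟩⟩
    · obtain ⟨g, hg⟩ := (h A).2 a
      exact ⟨g, (hπ g).trans hg⟩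
    · rw [hπ]
      refine ((h A).1 g).trans ⟨?_, ?_⟩
      · rintro ⟨k, rfl⟩
        exact ⟨k, hφ k⟩
      · rintro ⟨k, rfl⟩
        exact ⟨k, hφ k⟩
  · rintro ⟨X, Y, f, e, h⟩
    refine ⟨X, Y, preadditiveCoyoneda.map f.op, ofElem F e, fun A => ⟨fun g => ?_, h.gen⟩⟩
    refine (h.rel g).trans ⟨?_, ?_⟩
    · rintro ⟨k, rfl⟩
      exact ⟨k, rfl⟩
    · rintro ⟨k, rfl⟩
      exact ⟨k, rfl⟩

instance (F : FPFun R) : F.obj.Additive := F.property.1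

lemma FPFun.exists_presents (F : FPFun R) :
    ∃ (X Y : RMod R) (f : X ⟶ Y) (e : F.obj.obj X), Presents F.obj f e :=
  ((isFinPresFunctor_iff F.obj).1 F.property).2

instance : (isFinPresFunctor R).IsClosedUnderKernels where
  kernels_le := by
    rintro _ ⟨α, k, hk, hF, hG⟩
    rename_i F G
    rw [isFinPresFunctor_iff] at hF hG ⊢
    obtain ⟨_, X, Y, f, e, hf⟩ := hF
    obtain ⟨_, A, B, g, c, hg⟩ := hG
    have : Mono k.ι := Fork.IsLimit.mono hk
    have hadd : k.pt.Additive :=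
      (additiveFunctor (RMod R) AddCommGrpCat.{u}).prop_of_mono k.ι ‹F.Additive›
    have hinj : ∀ T, Function.Injective (k.ι.app T) := fun T =>
      (AddCommGrpCat.mono_iff_injective _).1 ((NatTrans.mono_iff_mono_app k.ι).1 inferInstance T)
    have hz : ∀ {T : RMod R} (x : k.pt.obj T), α.app T (k.ι.app T x) = 0 := fun {T} x => by
      have h := ConcreteCategory.congr_hom (NatTrans.congr_app k.condition T) x
      exact h.trans (ConcreteCategory.congr_hom (NatTrans.congr_app
        (comp_zero : k.ι ≫ (0 : F ⟶ G) = 0) T) x)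
    have hex : ∀ {T : RMod R} (x : F.obj T), α.app T x = 0 → ∃ y, k.ι.app T y = x :=
      fun {T} x hx => by
        obtain ⟨l, hl⟩ := KernelFork.IsLimit.lift' hk (ofElem F x) (by
          ext S h
          exact (nat_apply α (X := T) h x).trans ((congrArg (G.map h) hx).trans (map_zero _)))
        refine ⟨l.app T (𝟙 T), ?_⟩
        have := ConcreteCategory.congr_hom (NatTrans.congr_app hl T) (𝟙 T)
        refine this.trans ((ofElem_apply F x (𝟙 T)).trans ?_)
        rw [F.map_id]; rfl
    obtain ⟨u, hu⟩ := hg.gen (α.app X e)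
    have hsq : α.app _ (F.map (pushout.inl u g) e) = 0 := by
      rw [nat_apply, ← hu, ← map_comp_apply, hg.rel]
      exact ⟨pushout.inr u g, pushout.condition⟩
    obtain ⟨e', he'⟩ := hex _ hsq
    refine ⟨hadd, pushout u g, pushout (pushout.inl u g) f, pushout.inl _ _, e',
      ⟨fun {T} a => ?_, fun {T} h => ?_⟩⟩
    · obtain ⟨h, hh⟩ := hf.gen (k.ι.app T a)
      have h0 := hz a
      rw [← hh, nat_apply, ← hu, ← map_comp_apply, hg.rel] at h0
      obtain ⟨v, hv⟩ := h0
      refine ⟨pushout.desc h v hv, hinj T ?_⟩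
      rw [nat_apply, he', ← map_comp_apply, pushout.inl_desc, hh]
    · rw [← map_eq_zero_iff _ (hinj T), nat_apply, he', ← map_comp_apply, hf.rel]
      constructor
      · rintro ⟨y, hy⟩
        exact ⟨pushout.desc h y hy, by rw [pushout.inl_desc]⟩
      · rintro ⟨y, rfl⟩
        exact ⟨pushout.inr _ _ ≫ y, by rw [pushout.condition_assoc]⟩

instance : (isFinPresFunctor R).IsClosedUnderCokernels where
  cokernels_le := by
    rintro _ ⟨α, k, hk, hF, hG⟩
    rename_i F G
    rw [isFinPresFunctor_iff] at hF hG ⊢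
    obtain ⟨_, X, Y, f, e, hf⟩ := hF
    obtain ⟨_, A, B, g, c, hg⟩ := hG
    have : Epi k.π := Cofork.IsColimit.epi hk
    have hadd : k.pt.Additive :=
      (additiveFunctor (RMod R) AddCommGrpCat.{u}).prop_of_epi k.π ‹G.Additive›
    have hsurj : ∀ T, Function.Surjective (k.π.app T) := fun T =>
      (AddCommGrpCat.epi_iff_surjective _).1 ((NatTrans.epi_iff_epi_app k.π).1 inferInstance T)
    have hex : ∀ {T : RMod R} (x : G.obj T), k.π.app T x = 0 ↔ ∃ y, α.app T y = x := by
      intro T x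
      have hS : (ShortComplex.mk α k.π k.condition).Exact :=
        ShortComplex.exact_of_g_is_cokernel _ (IsColimit.ofIsoColimit hk (Cofork.ext (Iso.refl _)))
      have hS' := hS.map ((CategoryTheory.evaluation (RMod R) AddCommGrpCat.{u}).obj T)
      rw [ShortComplex.ab_exact_iff] at hS'
      refine ⟨hS' x, ?_⟩
      rintro ⟨y, rfl⟩
      exact ConcreteCategory.congr_hom (NatTrans.congr_app k.condition T) y
    obtain ⟨u, hu⟩ := hg.gen (α.app X e)
    refine ⟨hadd, A, X ⊞ B, biprod.lift u g, k.π.app A c, ⟨fun {T} a => ?_, fun {T} h => ?_⟩⟩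
    · obtain ⟨b, rfl⟩ := hsurj T a
      obtain ⟨h, rfl⟩ := hg.gen b
      exact ⟨h, (nat_apply k.π h c).symm⟩
    · rw [← nat_apply, hex]
      constructor
      · rintro ⟨x, hx⟩
        obtain ⟨t, rfl⟩ := hf.gen x
        have h0 : G.map (h - u ≫ t) c = 0 := by
          have h1 := map_add_apply G (h - u ≫ t) (u ≫ t) c
          rw [sub_add_cancel, map_comp_apply, hu, ← nat_apply, hx] at h1
          exact right_eq_add.1 h1
        obtain ⟨v, hv⟩ := (hg.rel _).1 h0
        refine ⟨biprod.desc t v, ?_⟩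
        rw [biprod.lift_desc, ← hv]
        abel
      · rintro ⟨y, rfl⟩
        refine ⟨F.map (biprod.inl ≫ y) e, ?_⟩
        have h1 : biprod.lift u g ≫ y = u ≫ biprod.inl ≫ y + g ≫ biprod.inr ≫ y := by
          rw [← Category.assoc, ← Category.assoc, ← Preadditive.add_comp]
          congr 1
          apply biprod.hom_ext <;> simp
        rw [nat_apply, ← hu, ← map_comp_apply, h1, map_add_apply,
          (hg.rel (g ≫ biprod.inr ≫ y)).2 ⟨_, rfl⟩, add_zero]

instance : (isFinPresFunctor R).ContainsZero where
  exists_zero := by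
    obtain ⟨Z, hZ⟩ := HasZeroObject.zero (C := RMod R ⥤ AddCommGrpCat.{u})
    have h : ∀ A, IsZero (Z.obj A) := (Functor.isZero_iff _).1 hZ
    have h' : ∀ A, Subsingleton (Z.obj A) := fun A => AddCommGrpCat.subsingleton_of_isZero (h A)
    refine ⟨Z, hZ, (isFinPresFunctor_iff Z).2 ⟨⟨fun {A B f g} => (h A).eq_of_src _ _⟩,
      ModuleCat.of _ PUnit, ModuleCat.of _ PUnit, 𝟙 _, 0, ⟨fun {A} a => ⟨0, Subsingleton.elim _ _⟩,
      fun {A} g => ⟨fun _ => ⟨g, (Category.id_comp g).symm⟩, fun _ => Subsingleton.elim _ _⟩⟩⟩⟩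

instance : (isFinPresFunctor R).IsClosedUnderIsomorphisms where
  of_iso {F G} i hF := by
    rw [isFinPresFunctor_iff] at hF ⊢
    obtain ⟨_, X, Y, f, e, hf⟩ := hF
    have h1 : ∀ {T : RMod R} (x : G.obj T), i.hom.app T (i.inv.app T x) = x := fun {T} x =>
      ConcreteCategory.congr_hom (NatTrans.congr_app i.inv_hom_id T) x
    have h2 : ∀ {T : RMod R} (x : F.obj T), i.inv.app T (i.hom.app T x) = x := fun {T} x =>
      ConcreteCategory.congr_hom (NatTrans.congr_app i.hom_inv_id T) x
    refine ⟨Functor.additive_of_iso i, X, Y, f, i.hom.app X e, ⟨fun {A} a => ?_, fun {A} g => ?_⟩⟩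
    · obtain ⟨g, hg⟩ := hf.gen (i.inv.app A a)
      exact ⟨g, by rw [← nat_apply, hg, h1]⟩
    · rw [← nat_apply, ← hf.rel]
      exact ⟨fun h => by rw [← h2 (F.map g e), h, map_zero], fun h => by rw [h, map_zero]⟩

instance : (isFinPresFunctor R).IsClosedUnderBinaryProducts where
  limitsOfShape_le := by
    rintro Z ⟨p⟩
    have hF := p.prop_diag_obj ⟨.left⟩
    have hG := p.prop_diag_obj ⟨.right⟩
    rw [isFinPresFunctor_iff] at hF hG
    obtain ⟨_, X, Y, f, e, hf⟩ := hF
    obtain ⟨_, A, B, g, c, hg⟩ := hG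
    let b : BinaryBicone (p.diag.obj ⟨.left⟩) (p.diag.obj ⟨.right⟩) :=
      BinaryBiproductData.bicone (getBinaryBiproductData _ _)
    have hb : b.IsBilimit := (getBinaryBiproductData _ _).isBilimit
    have hiso : b.pt ≅ Z := (hb.isLimit.conePointsIsoOfNatIso p.isLimit
      (mapPairIso (Iso.refl _) (Iso.refl _) ≪≫ (diagramIsoPair p.diag).symm :))
    refine (isFinPresFunctor R).prop_of_iso hiso ?_
    have hadd : b.pt.Additive := (additiveFunctor (RMod R) AddCommGrpCat.{u}).prop_of_isLimit
      hb.isLimit (by rintro ⟨_ | _⟩ <;> assumption)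
    rw [isFinPresFunctor_iff]
    have h1 : ∀ {T : RMod R} (x), b.fst.app T (b.inl.app T x) = x := fun {T} x =>
      ConcreteCategory.congr_hom (NatTrans.congr_app b.inl_fst T) x
    have h2 : ∀ {T : RMod R} (x), b.snd.app T (b.inr.app T x) = x := fun {T} x =>
      ConcreteCategory.congr_hom (NatTrans.congr_app b.inr_snd T) x
    have h3 : ∀ {T : RMod R} (x), b.snd.app T (b.inl.app T x) = 0 := fun {T} x =>
      ConcreteCategory.congr_hom (NatTrans.congr_app b.inl_snd T) x
    have h4 : ∀ {T : RMod R} (x), b.fst.app T (b.inr.app T x) = 0 := fun {T} x =>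
      ConcreteCategory.congr_hom (NatTrans.congr_app b.inr_fst T) x
    have htot : ∀ {T : RMod R} (x : b.pt.obj T),
        b.inl.app T (b.fst.app T x) + b.inr.app T (b.snd.app T x) = x := fun {T} x =>
      by
      have h : b.fst ≫ b.inl + b.snd ≫ b.inr = 𝟙 _ := hb.isLimit.hom_ext (by
        rintro ⟨_ | _⟩ <;> simp)
      exact ConcreteCategory.congr_hom (NatTrans.congr_app h T) x
    have key : ∀ {T : RMod R} (h : X ⊞ A ⟶ T),
        b.pt.map h (b.inl.app _ ((p.diag.obj ⟨.left⟩).map biprod.inl e) +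
          b.inr.app _ ((p.diag.obj ⟨.right⟩).map biprod.inr c)) =
        b.inl.app _ ((p.diag.obj ⟨.left⟩).map (biprod.inl ≫ h) e) +
          b.inr.app _ ((p.diag.obj ⟨.right⟩).map (biprod.inr ≫ h) c) := fun {T} h => by
      rw [map_add, ← nat_apply, ← nat_apply, map_comp_apply, map_comp_apply]
    refine ⟨hadd, X ⊞ A, Y ⊞ B, biprod.map f g,
      b.inl.app _ ((p.diag.obj ⟨.left⟩).map biprod.inl e) +
        b.inr.app _ ((p.diag.obj ⟨.right⟩).map biprod.inr c),
      ⟨fun {T} a => ?_, fun {T} h => ?_⟩⟩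
    · obtain ⟨s, hs⟩ := hf.gen (b.fst.app T a)
      obtain ⟨t, ht⟩ := hg.gen (b.snd.app T a)
      refine ⟨biprod.desc s t, ?_⟩
      rw [key, biprod.inl_desc, biprod.inr_desc, hs, ht, htot]
    · rw [key]
      constructor
      · intro h0
        have e1 := congrArg (b.fst.app T) h0
        have e2 := congrArg (b.snd.app T) h0
        rw [map_add, h1, h4, add_zero, map_zero, hf.rel] at e1
        rw [map_add, h2, h3, zero_add, map_zero, hg.rel] at e2
        obtain ⟨s, hs⟩ := e1
        obtain ⟨t, ht⟩ := e2
        exact ⟨biprod.desc s t, by apply biprod.hom_ext' <;> simp [hs, ht]⟩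
      · rintro ⟨k, rfl⟩
        rw [(hf.rel _).2 ⟨biprod.inl ≫ k, by simp⟩, (hg.rel _).2 ⟨biprod.inr ≫ k, by simp⟩]
        simp

instance : (isFinPresFunctor R).IsClosedUnderFiniteProducts :=
  ObjectProperty.IsClosedUnderFiniteProducts.mk'

variable (R) in
/-- The Yoneda embedding `Y(X) = (X, -)`. -/
def yonedaFP : (RMod R)ᵒᵖ ⥤ FPFun R :=
  (isFinPresFunctor R).lift preadditiveCoyoneda fun X => by
    refine (isFinPresFunctor_iff _).2 ⟨inferInstance, X.unop, ModuleCat.of _ PUnit, 0, 𝟙 X.unop,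
      ⟨fun {A} a => ⟨a, Category.id_comp a⟩, fun {A} g => ?_⟩⟩
    refine (Eq.congr_left (Category.id_comp g)).trans ⟨fun h => ⟨0, ?_⟩, ?_⟩
    · exact h.trans zero_comp.symm
    · rintro ⟨k, rfl⟩
      exact zero_comp

instance : (yonedaFP R).Additive where
  map_add {X X' f g} := by
    ext A h
    exact Preadditive.add_comp _ _ _ f.unop g.unop h

lemma surjective_app {F G : FPFun R} (p : F ⟶ G) [Epi p] (A : RMod R) :
    Function.Surjective (p.hom.app A) := by
  have : (isFinPresFunctor R).ι.PreservesEpimorphisms :=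
    ObjectProperty.preservesEpimorphisms_ι_of_isNormalMonoCategory _
  have : Epi p.hom := inferInstanceAs (Epi ((isFinPresFunctor R).ι.map p))
  exact (AddCommGrpCat.epi_iff_surjective _).1 ((NatTrans.epi_iff_epi_app p.hom).1 this A)

instance (X : (RMod R)ᵒᵖ) : Projective ((yonedaFP R).obj X) where
  factors {F G} f p _ := by
    obtain ⟨x, hx⟩ := surjective_app p X.unop (f.hom.app X.unop (𝟙 X.unop))
    refine ⟨ObjectProperty.homMk (ofElem F.obj x), ?_⟩
    ext A g
    refine (nat_apply p.hom (X := X.unop) g x).trans ((congrArg (G.obj.map g) hx).trans ?_)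
    refine (nat_apply f.hom (X := X.unop) g (𝟙 X.unop)).symm.trans ?_
    exact congrArg (f.hom.app A) (Category.id_comp (X := X.unop) g)

instance : EnoughProjectives (FPFun R) where
  presentation F := by
    obtain ⟨X, _, _, e, h⟩ := F.exists_presents
    let q : (yonedaFP R).obj (op X) ⟶ F := ObjectProperty.homMk (ofElem F.obj e)
    have hs : ∀ A : RMod R, Epi ((ofElem F.obj e).app A) := fun A =>
      (AddCommGrpCat.epi_iff_surjective ((ofElem F.obj e).app A)).2 fun a => h.gen a
    have : Epi ((isFinPresFunctor R).ι.map q) :=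
      (NatTrans.epi_iff_epi_app (ofElem F.obj e)).2 hs
    have : Epi q := (isFinPresFunctor R).ι.epi_of_epi_map this
    exact ⟨{ p := (yonedaFP R).obj (op X), f := q }⟩

end FinitelyPresentedFunctors

/-! ### The left adjoint `w` of the Yoneda embedding -/

section LeftAdjointOfYoneda

variable {R}

/-- Natural transformations out of a functor with a given presentation. -/
lemma Presents.exists_desc {F G : RMod R ⥤ AddCommGrpCat.{u}} [F.Additive] [G.Additive]
    {X Y : RMod R} {f : X ⟶ Y} {e : F.obj X} (h : Presents F f e) (x : G.obj X)
    (hx : G.map f x = 0) : ∃ α : F ⟶ G, α.app X e = x := by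
  choose r hr using fun (A : RMod R) (a : F.obj A) => h.gen a
  have key : ∀ {A : RMod R} (g g' : X ⟶ A), F.map g e = F.map g' e → G.map g x = G.map g' x := by
    intro A g g' hg
    have h0 := map_add_apply F (g - g') g' e
    rw [sub_add_cancel, hg] at h0
    obtain ⟨k, hk⟩ := (h.rel (g - g')).1 (right_eq_add.1 h0)
    have h1 := map_add_apply G (g - g') g' x
    rwa [sub_add_cancel, hk, map_comp_apply, hx, map_zero, zero_add] at h1
  refine ⟨{ app := fun A => AddCommGrpCat.ofHom (AddMonoidHom.mk' (fun a => G.map (r A a) x)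
              fun a b => ?_), naturality := fun A B k => ?_ }, ?_⟩
  · rw [← map_add_apply]
    apply key
    rw [hr, map_add_apply, hr, hr]
  · ext a
    change G.map (r B (F.map k a)) x = G.map k (G.map (r A a) x)
    rw [← map_comp_apply]
    apply key
    rw [hr, map_comp_apply, hr]
  · change G.map (r X e) x = x
    have := key (r X e) (𝟙 X) (by rw [hr, F.map_id]; rfl)
    rw [this, G.map_id]; rfl

lemma Presents.hom_ext {F G : RMod R ⥤ AddCommGrpCat.{u}} {X Y : RMod R} {f : X ⟶ Y}
    {e : F.obj X} (h : Presents F f e) {α β : F ⟶ G} (hαβ : α.app X e = β.app X e) : α = β := by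
  ext A a
  obtain ⟨g, rfl⟩ := h.gen a
  exact (nat_apply α g e).trans ((congrArg (G.map g) hαβ).trans (nat_apply β g e).symm)

instance : (yonedaFP R).IsRightAdjoint := by
  choose X Y f e h using fun F : FPFun R => F.exists_presents
  let K : FPFun R → (RMod R)ᵒᵖ := fun F => op (kernel (f F))
  have hK : ∀ F, ∃ φ : F ⟶ (yonedaFP R).obj (K F), φ.hom.app (X F) (e F) = kernel.ι (f F) :=
    fun F => by
      obtain ⟨α, hα⟩ := (h F).exists_desc (G := preadditiveCoyoneda.obj (K F))
        (kernel.ι (f F)) (kernel.condition (f F))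
      exact ⟨ObjectProperty.homMk α, hα⟩
  choose φ hφ using hK
  have hb : ∀ (F : FPFun R) (A : (RMod R)ᵒᵖ), Function.Bijective
      (fun g : K F ⟶ A => φ F ≫ (yonedaFP R).map g) := fun F A => by
    have hv : ∀ g : K F ⟶ A, (φ F ≫ (yonedaFP R).map g).hom.app (X F) (e F) =
        g.unop ≫ kernel.ι (f F) := fun g =>
      congrArg (fun z : kernel (f F) ⟶ X F => g.unop ≫ z) (hφ F)
    refine ⟨fun g g' hg => ?_, fun α => ?_⟩
    · have : g.unop ≫ kernel.ι (f F) = g'.unop ≫ kernel.ι (f F) := by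
        rw [← hv, ← hv]
        exact congrArg (fun α : F ⟶ (yonedaFP R).obj A => α.hom.app (X F) (e F)) hg
      exact Quiver.Hom.unop_inj ((cancel_mono (kernel.ι (f F))).1 this)
    · let j : A.unop ⟶ X F := α.hom.app (X F) (e F)
      have hj : j ≫ f F = 0 := by
        have h1 := (nat_apply α.hom (f F) (e F)).symm
        rw [((h F).rel (f F)).2 ⟨𝟙 _, (Category.comp_id _).symm⟩, map_zero] at h1
        exact h1
      refine ⟨(kernel.lift (f F) j hj).op, ?_⟩
      apply ObjectProperty.hom_ext
      apply (h F).hom_ext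
      exact (hv _).trans (kernel.lift_ι (f F) j hj)
  exact (Adjunction.adjunctionOfEquivLeft (F_obj := K)
    (fun F A => Equiv.ofBijective _ (hb F A)) (fun F A A' g k => by simp)).isRightAdjoint

end LeftAdjointOfYoneda

/-- The contravariant functor `w : fp(Mod(R), Ab) ⥤ Mod(R)` adjoint to the Yoneda embedding:
`Nat(F, (X, -)) ≅ Hom(X, w F)`. -/
noncomputable def w : (FPFun R)ᵒᵖ ⥤ RMod R := (yonedaFP R).leftAdjoint.leftOp

/-- The canonical morphism `X ⟶ w (X, -)`. -/
noncomputable def toW (X : RMod R) : X ⟶ (w R).obj (op ((yonedaFP R).obj (op X))) :=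
  ((Adjunction.ofIsRightAdjoint (yonedaFP R)).counit.app (op X)).unop

instance : (w R).Additive := by
  have : (yonedaFP R).leftAdjoint.Additive :=
    (Adjunction.ofIsRightAdjoint (yonedaFP R)).left_adjoint_additive
  exact inferInstanceAs ((yonedaFP R).leftAdjoint.leftOp.Additive)

/-! ### The tensor embedding -/

section Tensor

open TensorProduct

variable {R}
variable (X L : Type u) [AddCommGroup X] [Module Rᵐᵒᵖ X] [AddCommGroup L] [Module R L]

variable (R) in
/-- The relations `(x r) ⊗ l = x ⊗ (r l)`. -/
def tensorRel : AddSubgroup (X ⊗[ℤ] L) :=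
  AddSubgroup.closure {z | ∃ (x : X) (r : R) (l : L),
    z = (MulOpposite.op r • x) ⊗ₜ[ℤ] l - x ⊗ₜ[ℤ] (r • l)}

variable (R) in
/-- The tensor product `X ⊗_R L` of a right module and a left module. -/
def RTensor : Type u := (X ⊗[ℤ] L) ⧸ tensorRel R X L

instance : AddCommGroup (RTensor R X L) :=
  inferInstanceAs (AddCommGroup ((X ⊗[ℤ] L) ⧸ tensorRel R X L))

variable {X L}

variable (R) in
/-- The pure tensor `x ⊗ l`. -/
def rtmul (x : X) (l : L) : RTensor R X L := QuotientAddGroup.mk' (tensorRel R X L) (x ⊗ₜ[ℤ] l)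

lemma rtmul_add (x : X) (l l' : L) : rtmul R x (l + l') = rtmul R x l + rtmul R x l' := by
  simp only [rtmul, TensorProduct.tmul_add, map_add]
  rfl

lemma add_rtmul (x x' : X) (l : L) : rtmul R (x + x') l = rtmul R x l + rtmul R x' l := by
  simp only [rtmul, TensorProduct.add_tmul, map_add]
  rfl

lemma rtmul_smul (x : X) (r : R) (l : L) :
    rtmul R (MulOpposite.op r • x) l = rtmul R x (r • l) := by
  refine (QuotientAddGroup.eq_iff_sub_mem).2 ?_
  exact AddSubgroup.subset_closure ⟨x, r, l, rfl⟩

lemma RTensor.hom_ext {G : Type*} [AddCommGroup G] {f g : RTensor R X L →+ G}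
    (h : ∀ x l, f (rtmul R x l) = g (rtmul R x l)) : f = g := by
  refine QuotientAddGroup.addMonoidHom_ext (tensorRel R X L) ?_
  ext z
  induction z with
  | zero => simp
  | tmul x l => exact h x l
  | add a b ha hb => rw [map_add, map_add, ha, hb]

variable {X' L' : Type u} [AddCommGroup X'] [Module Rᵐᵒᵖ X'] [AddCommGroup L']
  [Module R L']

/-- The map `f ⊗ g`. -/
def RTensor.map (f : X →ₗ[Rᵐᵒᵖ] X') (g : L →ₗ[R] L') : RTensor R X L →+ RTensor R X' L' :=
  QuotientAddGroup.map (tensorRel R X L) (tensorRel R X' L')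
    (TensorProduct.map f.toAddMonoidHom.toIntLinearMap g.toAddMonoidHom.toIntLinearMap).toAddMonoidHom
    ((AddSubgroup.closure_le _).2 (by
      rintro _ ⟨x, r, l, rfl⟩
      refine AddSubgroup.subset_closure ⟨f x, r, g l, ?_⟩
      simp))

lemma RTensor.map_rtmul (f : X →ₗ[Rᵐᵒᵖ] X') (g : L →ₗ[R] L') (x : X) (l : L) :
    RTensor.map f g (rtmul R x l) = rtmul R (f x) (g l) := rfl

end Tensor

/-- The tensor embedding `t(X) = X ⊗_R -`. -/
def t : RMod R ⥤ LFun R where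
  obj X :=
    { obj :=
        { obj := fun L => AddCommGrpCat.of (RTensor R X L.obj)
          map := fun {L L'} g => AddCommGrpCat.ofHom (RTensor.map LinearMap.id g.hom.hom)
          map_id := fun L => AddCommGrpCat.hom_ext (RTensor.hom_ext fun x l => rfl)
          map_comp := fun f g => AddCommGrpCat.hom_ext (RTensor.hom_ext fun x l => rfl) }
      property := ⟨fun {L L' f g} => AddCommGrpCat.hom_ext (RTensor.hom_ext fun x l =>
        rtmul_add x (f.hom.hom l) (g.hom.hom l))⟩ }
  map {X X'} f := ObjectProperty.homMk
    { app := fun L => AddCommGrpCat.ofHom (RTensor.map f.hom LinearMap.id)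
      naturality := fun L L' g => AddCommGrpCat.hom_ext (RTensor.hom_ext fun x l => rfl) }
  map_id X := by
    ext L : 4
    exact RTensor.hom_ext fun x l => rfl
  map_comp f g := by
    ext L : 4
    exact RTensor.hom_ext fun x l => rfl

instance : (t R).Additive where
  map_add {X X' f g} := by
    ext L : 4
    exact RTensor.hom_ext fun x l => add_rtmul (f.hom x) (g.hom x) l

/-! ### Evaluation at `R` -/

/-- The regular left module `R`, as an object of `mod(Rᵒᵖ)`. -/
def regular : FPLMod R := ⟨ModuleCat.of R R, inferInstanceAs (Module.FinitePresentation R R)⟩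

/-- Right multiplication by `r`, as an endomorphism of the left module `R`. -/
def rightMul (r : R) : regular R ⟶ regular R :=
  ObjectProperty.homMk (ModuleCat.ofHom (LinearMap.toSpanSingleton R R r))

lemma rightMul_one : rightMul R 1 = 𝟙 _ := by
  apply ObjectProperty.hom_ext
  exact ModuleCat.hom_ext (LinearMap.ext fun x : R => mul_one x)

lemma rightMul_mul (r s : R) : rightMul R (r * s) = rightMul R r ≫ rightMul R s := by
  apply ObjectProperty.hom_ext
  exact ModuleCat.hom_ext (LinearMap.ext fun x : R => (mul_assoc x r s).symm)

lemma rightMul_add (r s : R) : rightMul R (r + s) = rightMul R r + rightMul R s := by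
  apply ObjectProperty.hom_ext
  exact ModuleCat.hom_ext (LinearMap.ext fun x : R => mul_add x r s)

lemma rightMul_zero : rightMul R 0 = 0 := by
  apply ObjectProperty.hom_ext
  exact ModuleCat.hom_ext (LinearMap.ext fun x : R => mul_zero x)

variable {R}

/-- The right `R`-module structure on `G(R)`: `r` acts by `G(- * r)`. -/
abbrev evModule (G : LFun R) : Module Rᵐᵒᵖ (G.obj.obj (regular R)) where
  smul r g := G.obj.map (rightMul R r.unop) g
  one_smul g := by
    change G.obj.map (rightMul R 1) g = g
    rw [rightMul_one, G.obj.map_id]; rfl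
  mul_smul r s g := by
    change G.obj.map (rightMul R (s.unop * r.unop)) g =
      G.obj.map (rightMul R r.unop) (G.obj.map (rightMul R s.unop) g)
    rw [rightMul_mul, G.obj.map_comp]; rfl
  smul_zero r := map_zero _
  smul_add r := map_add _
  add_smul r s g := by
    change G.obj.map (rightMul R (r.unop + s.unop)) g = _
    rw [rightMul_add, G.obj.map_add]; rfl
  zero_smul g := by
    change G.obj.map (rightMul R 0) g = 0
    rw [rightMul_zero, G.obj.map_zero]; rfl

variable (R)

/-- Evaluation at the ring, `ev_R(G) = G(R)`. -/
def evR : LFun R ⥤ RMod R where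
  obj G := letI := evModule G; ModuleCat.of Rᵐᵒᵖ (G.obj.obj (regular R))
  map {G H} α := letI := evModule G; letI := evModule H; ModuleCat.ofHom
    { toFun := α.hom.app (regular R)
      map_add' := map_add _
      map_smul' := fun r g =>
        ConcreteCategory.congr_hom (α.hom.naturality (rightMul R r.unop)) g }
  map_id _ := rfl
  map_comp _ _ := rfl

instance : (evR R).Additive where
  map_add := rfl

/-- The canonical morphism `X ⟶ (X ⊗_R -)(R)`, `x ↦ x ⊗ 1`. -/
def toEvT (X : RMod R) : X ⟶ (evR R).obj ((t R).obj X) :=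
  letI := evModule ((t R).obj X)
  ModuleCat.ofHom
    { toFun := fun x => (rtmul R x (1 : R) : RTensor R X R)
      map_add' := fun x y => add_rtmul x y (1 : R)
      map_smul' := fun r x => by
        refine (rtmul_smul x r.unop (1 : R)).trans ?_
        exact congrArg (rtmul R x) ((mul_one r.unop).trans (one_mul r.unop).symm) }

/-! ### The functors `D_A` and `D_L` and the transformation `γ` -/

/-- The Auslander-Gruson-Jensen functor `D_A = R₀(t ∘ w) : fp(Mod(R), Ab) ⥤ (mod(Rᵒᵖ), Ab)`
(contravariant): the zeroth right derived functor of `t ∘ w`, computed from projective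
resolutions in `fp(Mod(R), Ab)`. -/
noncomputable def DA : (FPFun R)ᵒᵖ ⥤ LFun R := (w R ⋙ t R).rightDerived 0

/-- The contravariant functor `Y ∘ ev_R : G ↦ (G(R), -)`. -/
def YevR : (LFun R)ᵒᵖ ⥤ FPFun R := (evR R).op ⋙ yonedaFP R

instance : (YevR R).Additive := inferInstanceAs ((evR R).op ⋙ yonedaFP R).Additive

/-- `D_L = L⁰(Y ∘ ev_R) : (mod(Rᵒᵖ), Ab) ⥤ fp(Mod(R), Ab)` (contravariant): the zeroth left
derived functor of `Y ∘ ev_R`, computed from injective resolutions in `(mod(Rᵒᵖ), Ab)`. -/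
noncomputable def DL : (LFun R)ᵒᵖ ⥤ FPFun R := (YevR R).leftDerived 0

/-- The canonical morphism `X ⊗ - ⟶ D_A (X, -)`. -/
noncomputable def tToDA (X : RMod R) :
    (t R).obj X ⟶ (DA R).obj (op ((yonedaFP R).obj (op X))) :=
  (t R).map (toW R X) ≫
    (w R ⋙ t R).toRightDerivedZero.app (op ((yonedaFP R).obj (op X)))

/-- The component of `γ` at a representable functor,
`D_L D_A (X, -) ≅ D_L (X ⊗ -) ⟶ ((X ⊗ -)(R), -) ≅ (X, -)`, where the middle map is the canonical
morphism `L⁰(Y ∘ ev_R) ⟶ Y ∘ ev_R` evaluated at `X ⊗ -`. -/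
noncomputable def gammaRep (X : RMod R) :
    (DL R).obj (op ((DA R).obj (op ((yonedaFP R).obj (op X))))) ⟶ (yonedaFP R).obj (op X) :=
  (DL R).map (tToDA R X).op ≫ (YevR R).fromLeftDerivedZero.app (op ((t R).obj X)) ≫
    (yonedaFP R).map (toEvT R X).op

end AGJ

namespace AGJ

/-! ### Zeroth derived functors -/

section ZerothDerived

universe v₁ v₂ u₁ u₂

variable {C : Type u₁} [Category.{v₁} C] {D : Type u₂} [Category.{v₂} D] [Abelian C] [Abelian D]

/-! On representables and on injectives both functors are explicit. The functor $(X,-)$ is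
projective and `w` inverts Yoneda on representables, so $D_A(X,-) \cong X\otimes_R -$. An injective
$I$ is projective in the opposite category, so $D_L I \cong (I(R),-)$. Everything else is extended
from these two classes by one-sided exactness.

Exactness of $D_A$: a zeroth right derived functor is left exact
(`preservesFiniteLimits_of_exists_exact`), so $D_A F$ is the kernel of $X\otimes - \to Y\otimes -$
whenever $(Y,-)\to(X,-)\to F\to 0$ is exact. A monomorphism $F\to G$ allows $F$ to be presented by a
pushout of the presentation of $G$. Since `t` is a left adjoint it preserves this pushout, and a
pushout square induces an epimorphism of kernels; hence $D_A G\to D_A F$ is epi (`DA_epi`).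

Unit: an injective $I$ is right exact on finitely presented modules, so $I(R)\otimes_R - \cong I$ by
an Eilenberg-Watts argument (`tensorEval_bijective`), which gives $D_A D_L I\cong I$. For arbitrary
$G$, an injective copresentation is sent by $D_A D_L$ to a left exact sequence, so the isomorphism
passes to kernels.

Adjunction: $\alpha\mapsto D_A(\alpha)$ followed by the unit map is bijective. For $I$ injective and
$F=(X,-)$ both groups are $\mathrm{Hom}_R(X,I(R))$ by Yoneda and $t\dashv \mathrm{ev}_R$.
Presentations of $F$, then copresentations of $G$, give the general case. Full faithfulness of $D_L$
follows from the invertible unit, and $\gamma$ is the counit. -/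

instance rightDerived_additive [HasInjectiveResolutions C] (T : C ⥤ D) [T.Additive] (n : ℕ) :
    (T.rightDerived n).Additive where
  map_add {X Y f g} := by
    let I := injectiveResolution X
    let J := injectiveResolution Y
    have h := fun k : X ⟶ Y => T.rightDerived_map_eq n k (InjectiveResolution.desc k J I)
      (InjectiveResolution.desc_commutes k J I)
    rw [h f, h g, T.rightDerived_map_eq n (f + g)
      (InjectiveResolution.desc f J I + InjectiveResolution.desc g J I)
      (by rw [Preadditive.comp_add, InjectiveResolution.desc_commutes,
        InjectiveResolution.desc_commutes, Functor.map_add, Preadditive.add_comp]),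
      Functor.map_add, Preadditive.add_comp, Preadditive.comp_add]

instance leftDerived_additive [HasProjectiveResolutions C] (T : C ⥤ D) [T.Additive] (n : ℕ) :
    (T.leftDerived n).Additive where
  map_add {X Y f g} := by
    let I := projectiveResolution X
    let J := projectiveResolution Y
    have h := fun k : X ⟶ Y => T.leftDerived_map_eq n k (ProjectiveResolution.lift k I J)
      (ProjectiveResolution.lift_commutes k I J)
    rw [h f, h g, T.leftDerived_map_eq n (f + g)
      (ProjectiveResolution.lift f I J + ProjectiveResolution.lift g I J)
      (by rw [Preadditive.add_comp, ProjectiveResolution.lift_commutes,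
        ProjectiveResolution.lift_commutes, Functor.map_add, Preadditive.comp_add]),
      Functor.map_add, Preadditive.add_comp, Preadditive.comp_add]

/-- The zeroth left derived functor in terms of opcycles of a projective resolution. -/
noncomputable def isoLeftDerivedZero [HasProjectiveResolutions C] (T : C ⥤ D) [T.Additive] {X : C}
    (P : ProjectiveResolution X) : (T.leftDerived 0).obj X ≅
      ((T.mapHomologicalComplex _).obj P.complex).opcycles 0 :=
  Iso.trans (Y := ((T.mapHomologicalComplex _).obj P.complex).homology 0)
    (P.isoLeftDerivedObj T 0) (ChainComplex.isoHomologyι₀ _)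

/-- The morphism to the zeroth left derived functor from the value at the degree zero term of a
projective resolution. -/
noncomputable def toLeftDerivedZero [HasProjectiveResolutions C] (T : C ⥤ D) [T.Additive] {X : C}
    (P : ProjectiveResolution X) : T.obj (P.complex.X 0) ⟶ (T.leftDerived 0).obj X :=
  (((T.mapHomologicalComplex _).obj P.complex).pOpcycles 0 ≫ (isoLeftDerivedZero T P).inv :)

lemma isoLeftDerivedZero_naturality [HasProjectiveResolutions C] (T : C ⥤ D) [T.Additive]
    {X Y : C} (f : X ⟶ Y) (P : ProjectiveResolution X) (Q : ProjectiveResolution Y)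
    (φ : P.complex ⟶ Q.complex) (hφ : φ.f 0 ≫ Q.π.f 0 = P.π.f 0 ≫ f) :
    (T.leftDerived 0).map f ≫ (isoLeftDerivedZero T Q).hom =
      (isoLeftDerivedZero T P).hom ≫
        HomologicalComplex.opcyclesMap ((T.mapHomologicalComplex _).map φ) 0 := by
  have h := ProjectiveResolution.isoLeftDerivedObj_hom_naturality f P Q φ hφ T 0
  have h' := (Iso.eq_comp_inv _).1 (((Iso.inv_comp_eq _).1 (ChainComplex.isoHomologyι₀_inv_naturality
    ((T.mapHomologicalComplex _).map φ))).trans (Category.assoc _ _ _).symm)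
  exact (Category.assoc _ _ _).symm.trans ((h =≫ (ChainComplex.isoHomologyι₀ _).hom).trans
    ((Category.assoc _ _ _).trans ((congrArg ((P.isoLeftDerivedObj T 0).hom ≫ ·) h').trans
      (Category.assoc _ _ _).symm)))

/-- The trivial resolution of the projective $P_0$ maps to $P$ by the identity in degree zero,
lifting the augmentation; naturality along this chain map gives the formula. The variable `p` is
`P.π.f 0` with its target read as `X` rather than as a term of a single complex. -/
lemma fromLeftDerivedZero_toLeftDerivedZero [HasProjectiveResolutions C] (T : C ⥤ D) [T.Additive]
    {X : C} (P : ProjectiveResolution X) (p : P.complex.X 0 ⟶ X) (hp : P.π.f 0 = p) :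
    T.fromLeftDerivedZero.app (P.complex.X 0) ≫ toLeftDerivedZero T P =
      (T.leftDerived 0).map p := by
  let Q := ProjectiveResolution.self (P.complex.X 0)
  let φ : Q.complex ⟶ P.complex := (ChainComplex.fromSingle₀Equiv _ _).symm (𝟙 _)
  have hφ : φ.f 0 = 𝟙 _ := ChainComplex.fromSingle₀Equiv_symm_apply_f_zero _
  have h := isoLeftDerivedZero_naturality T p Q P φ (by
    subst hp; rw [hφ]; exact (Category.id_comp _).trans (Category.id_comp _).symm)
  rw [← cancel_mono (isoLeftDerivedZero T P).hom, h]
  have h₁ : T.fromLeftDerivedZero.app (P.complex.X 0) =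
      (isoLeftDerivedZero T Q).hom ≫ Q.fromLeftDerivedZero' T :=
    (Q.fromLeftDerivedZero_eq T).trans (Category.assoc _ _ _).symm
  have h₂ : toLeftDerivedZero T P ≫ (isoLeftDerivedZero T P).hom =
      HomologicalComplex.pOpcycles ((T.mapHomologicalComplex _).obj P.complex) 0 :=
    (Category.assoc _ _ _).trans ((congrArg (_ ≫ ·) (Iso.inv_hom_id _)).trans (Category.comp_id _))
  rw [h₁, Category.assoc, Category.assoc]
  refine congrArg ((isoLeftDerivedZero T Q).hom ≫ ·) ?_
  refine (congrArg (Q.fromLeftDerivedZero' T ≫ ·) h₂).trans ?_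
  rw [← cancel_epi (HomologicalComplex.pOpcycles _ _), HomologicalComplex.p_opcyclesMap]
  refine (Category.assoc _ _ _).symm.trans (congrArg (· ≫ _)
    ((Q.pOpcycles_comp_fromLeftDerivedZero' T).trans (?_ : T.map (𝟙 _) = T.map (φ.f 0))))
  rw [hφ]
  rfl

/-- Nothing leaves degree zero of a chain complex, so the homology there is the cokernel of the
incoming differential. -/
lemma toLeftDerivedZero_exact [HasProjectiveResolutions C] (T : C ⥤ D) [T.Additive] {X : C}
    (P : ProjectiveResolution X) : ∃ w : T.map (P.complex.d 1 0) ≫ toLeftDerivedZero T P = 0,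
      (ShortComplex.mk _ _ w).Exact ∧ Epi (toLeftDerivedZero T P) := by
  let K := (T.mapHomologicalComplex _).obj P.complex
  have w : K.d 1 0 ≫ K.pOpcycles 0 = 0 := K.d_pOpcycles 1 0
  have h := ShortComplex.exact_of_g_is_cokernel (.mk _ _ w) (K.opcyclesIsCokernel 1 0 (by simp))
  have w' : T.map (P.complex.d 1 0) ≫ toLeftDerivedZero T P = 0 :=
    (Category.assoc _ _ _).symm.trans ((w =≫ (isoLeftDerivedZero T P).inv).trans zero_comp)
  refine ⟨w', ShortComplex.exact_of_iso ?_ h, ?_⟩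
  · exact ShortComplex.isoMk (Iso.refl _) (Iso.refl _) (isoLeftDerivedZero T P).symm
      ((Category.id_comp _).trans (Category.comp_id _).symm) (Category.id_comp _)
  · exact inferInstanceAs (Epi (K.pOpcycles 0 ≫ (isoLeftDerivedZero T P).inv))

/-- The zeroth left derived functor sends some projective presentation of each object to a
right exact sequence. -/
lemma exists_leftDerived_zero_exact [HasProjectiveResolutions C] (T : C ⥤ D) [T.Additive]
    (X : C) : ∃ (P₁ P₀ : C) (d : P₁ ⟶ P₀) (p : P₀ ⟶ X) (w : d ≫ p = 0),
      Projective P₁ ∧ Projective P₀ ∧ (ShortComplex.mk d p w).Exact ∧ Epi p ∧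
      ((ShortComplex.mk d p w).map (T.leftDerived 0)).Exact ∧ Epi ((T.leftDerived 0).map p) := by
  let P := projectiveResolution X
  obtain ⟨w, h, _⟩ := toLeftDerivedZero_exact T P
  have e := fromLeftDerivedZero_toLeftDerivedZero T P (P.π.f 0) rfl
  refine ⟨P.complex.X 1, P.complex.X 0, P.complex.d 1 0, P.π.f 0, P.complex_d_comp_π_f_zero,
    inferInstance, inferInstance, P.exact₀, inferInstanceAs (Epi (P.π.f 0)), ?_, ?_⟩
  -- The comparison with `T` is invertible on the projective terms, so the derived sequence is
  -- isomorphic to the cokernel sequence of `toLeftDerivedZero_exact`.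
  · have h₀ : ∀ (Z : C) [Projective Z], IsIso (T.fromLeftDerivedZero.app Z) :=
      fun Z _ => inferInstance
    have := h₀ (P.complex.X 0)
    have := h₀ (P.complex.X 1)
    let e₁ := asIso (T.fromLeftDerivedZero.app (P.complex.X 1))
    let e₂ := asIso (T.fromLeftDerivedZero.app (P.complex.X 0))
    let S := (ShortComplex.mk _ _ P.complex_d_comp_π_f_zero).map (T.leftDerived 0)
    have i : S ≅ ShortComplex.mk _ _ w := ShortComplex.isoMk
      e₁ e₂ (Iso.refl _)
      (T.fromLeftDerivedZero.naturality (P.complex.d 1 0)).symm (e.trans (Category.comp_id _).symm)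
    exact ShortComplex.exact_of_iso i.symm h
  · refine (congrArg Epi e).mp ?_
    infer_instance

/-- The zeroth right derived functor in terms of cycles of an injective resolution. -/
noncomputable def isoRightDerivedZero [HasInjectiveResolutions C] (T : C ⥤ D) [T.Additive] {X : C}
    (I : InjectiveResolution X) : (T.rightDerived 0).obj X ≅
      ((T.mapHomologicalComplex _).obj I.cocomplex).cycles 0 :=
  Iso.trans (Y := ((T.mapHomologicalComplex _).obj I.cocomplex).homology 0)
    (I.isoRightDerivedObj T 0) (CochainComplex.isoHomologyπ₀ _).symm

/-- The morphism from the zeroth right derived functor to the value at the degree zero term of an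
injective resolution. -/
noncomputable def fromRightDerivedZero [HasInjectiveResolutions C] (T : C ⥤ D) [T.Additive] {X : C}
    (I : InjectiveResolution X) : (T.rightDerived 0).obj X ⟶ T.obj (I.cocomplex.X 0) :=
  ((isoRightDerivedZero T I).hom ≫ ((T.mapHomologicalComplex _).obj I.cocomplex).iCycles 0 :)

lemma isoRightDerivedZero_naturality [HasInjectiveResolutions C] (T : C ⥤ D) [T.Additive]
    {X Y : C} (f : X ⟶ Y) (I : InjectiveResolution X) (J : InjectiveResolution Y)
    (φ : I.cocomplex ⟶ J.cocomplex) (hφ : I.ι.f 0 ≫ φ.f 0 = f ≫ J.ι.f 0) :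
    (T.rightDerived 0).map f ≫ (isoRightDerivedZero T J).hom =
      (isoRightDerivedZero T I).hom ≫
        HomologicalComplex.cyclesMap ((T.mapHomologicalComplex _).map φ) 0 := by
  have h := InjectiveResolution.isoRightDerivedObj_hom_naturality f I J φ hφ T 0
  exact (Category.assoc _ _ _).symm.trans ((h =≫ (CochainComplex.isoHomologyπ₀ _).inv).trans
    ((Category.assoc _ _ _).trans ((congrArg ((I.isoRightDerivedObj T 0).hom ≫ ·)
      (CochainComplex.isoHomologyπ₀_inv_naturality ((T.mapHomologicalComplex _).map φ))).trans
        (Category.assoc _ _ _).symm)))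

lemma fromRightDerivedZero_toRightDerivedZero [HasInjectiveResolutions C] (T : C ⥤ D)
    [T.Additive] {X : C} (I : InjectiveResolution X) (i : X ⟶ I.cocomplex.X 0)
    (hi : I.ι.f 0 = i) :
    fromRightDerivedZero T I ≫ T.toRightDerivedZero.app (I.cocomplex.X 0) =
      (T.rightDerived 0).map i := by
  let Q := InjectiveResolution.self (I.cocomplex.X 0)
  let φ : I.cocomplex ⟶ Q.cocomplex := (CochainComplex.toSingle₀Equiv _ _).symm (𝟙 _)
  have hφ : φ.f 0 = 𝟙 _ := CochainComplex.toSingle₀Equiv_symm_apply_f_zero _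
  have h := isoRightDerivedZero_naturality T i I Q φ (by subst hi; rw [hφ]; rfl)
  rw [← cancel_mono (isoRightDerivedZero T Q).hom, h]
  have h₁ : T.toRightDerivedZero.app (I.cocomplex.X 0) ≫ (isoRightDerivedZero T Q).hom =
      Q.toRightDerivedZero' T := by
    rw [← Iso.eq_comp_inv]
    exact Q.toRightDerivedZero_eq T
  rw [Category.assoc, h₁]
  refine (Category.assoc _ _ _).trans (congrArg ((isoRightDerivedZero T I).hom ≫ ·) ?_)
  rw [← cancel_mono (HomologicalComplex.iCycles _ _), HomologicalComplex.cyclesMap_i]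
  refine (Category.assoc _ _ _).trans (congrArg (_ ≫ ·)
    ((Q.toRightDerivedZero'_comp_iCycles T).trans (?_ : T.map (𝟙 _) = T.map (φ.f 0))))
  rw [hφ]
  rfl

lemma fromRightDerivedZero_exact [HasInjectiveResolutions C] (T : C ⥤ D) [T.Additive] {X : C}
    (I : InjectiveResolution X) :
    ∃ w : fromRightDerivedZero T I ≫ T.map (I.cocomplex.d 0 1) = 0,
      (ShortComplex.mk _ _ w).Exact ∧ Mono (fromRightDerivedZero T I) := by
  let K := (T.mapHomologicalComplex _).obj I.cocomplex
  have w : K.iCycles 0 ≫ K.d 0 1 = 0 := K.iCycles_d 0 1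
  have h := ShortComplex.exact_of_f_is_kernel (.mk _ _ w) (K.cyclesIsKernel 0 1 (by simp))
  have w' : fromRightDerivedZero T I ≫ T.map (I.cocomplex.d 0 1) = 0 :=
    (Category.assoc _ _ _).trans (((isoRightDerivedZero T I).hom ≫= w).trans comp_zero)
  refine ⟨w', ShortComplex.exact_of_iso ?_ h, ?_⟩
  · have i : ShortComplex.mk _ _ w' ≅ ShortComplex.mk _ _ w := ShortComplex.isoMk
      (isoRightDerivedZero T I) (Iso.refl _) (Iso.refl _) (Category.comp_id _).symm
      ((Category.id_comp _).trans (Category.comp_id _).symm)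
    exact i.symm
  · exact inferInstanceAs (Mono ((isoRightDerivedZero T I).hom ≫ K.iCycles 0))

/-- The zeroth right derived functor sends some injective copresentation of each object to a
left exact sequence. -/
lemma exists_rightDerived_zero_exact [HasInjectiveResolutions C] (T : C ⥤ D) [T.Additive]
    (X : C) : ∃ (I₀ I₁ : C) (i : X ⟶ I₀) (d : I₀ ⟶ I₁) (w : i ≫ d = 0), Injective I₀ ∧ Mono i ∧
      ((ShortComplex.mk i d w).map (T.rightDerived 0)).Exact ∧
      Mono ((T.rightDerived 0).map i) := by
  let I := injectiveResolution X
  obtain ⟨w, h, _⟩ := fromRightDerivedZero_exact T I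
  have e := fromRightDerivedZero_toRightDerivedZero T I (I.ι.f 0) rfl
  refine ⟨I.cocomplex.X 0, I.cocomplex.X 1, I.ι.f 0, I.cocomplex.d 0 1,
    I.ι_f_zero_comp_complex_d, inferInstance, inferInstanceAs (Mono (I.ι.f 0)), ?_, ?_⟩
  · have h₀ : ∀ (Z : C) [Injective Z], IsIso (T.toRightDerivedZero.app Z) :=
      fun Z _ => inferInstance
    have := h₀ (I.cocomplex.X 0)
    have := h₀ (I.cocomplex.X 1)
    let e₁ := asIso (T.toRightDerivedZero.app (I.cocomplex.X 1))
    let e₂ := asIso (T.toRightDerivedZero.app (I.cocomplex.X 0))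
    let S := (ShortComplex.mk _ _ I.ι_f_zero_comp_complex_d).map (T.rightDerived 0)
    have i : ShortComplex.mk _ _ w ≅ S := ShortComplex.isoMk (Iso.refl _) e₂
      e₁
      ((Category.id_comp _).trans e.symm) (T.toRightDerivedZero.naturality _).symm
    exact ShortComplex.exact_of_iso i h
  · refine (congrArg Mono e).mp ?_
    infer_instance

/-- An additive functor is left exact if it sends some complex `X ⟶ I ⟶ J`, with `X ⟶ I` a
monomorphism to an injective object, to a left exact sequence, for each `X`. -/
lemma preservesFiniteLimits_of_exists_exact (S : C ⥤ D) [S.Additive]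
    (h : ∀ X : C, ∃ (I J : C) (i : X ⟶ I) (d : I ⟶ J) (w : i ≫ d = 0), Injective I ∧ Mono i ∧
      ((ShortComplex.mk i d w).map S).Exact ∧ Mono (S.map i)) : PreservesFiniteLimits S := by
  -- The map `j` into an injective extends along `f`, which makes `S.map f` the first factor of the
  -- monomorphism `S.map j`.
  have hmono : ∀ {X Y : C} (f : X ⟶ Y) [Mono f], Mono (S.map f) := fun {X Y} f _ => by
    obtain ⟨I, _, j, _, _, _, _, _, _⟩ := h X
    have : Mono (S.map f ≫ S.map (Injective.factorThru j f)) := by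
      rwa [← S.map_comp, Injective.comp_factorThru]
    exact mono_of_mono _ (S.map (Injective.factorThru j f))
  refine ((S.preservesFiniteLimits_tfae).out 0 3).1 fun E hE => ?_
  have := hE.mono_f
  have := hE.epi_g
  refine ⟨?_, hmono _⟩
  obtain ⟨I, J, j, d, w, _, _, hj, _⟩ := h E.X₁
  let k : E.X₂ ⟶ I := Injective.factorThru j E.f
  have hk : E.f ≫ k = j := Injective.comp_factorThru _ _
  -- The composite `k ≫ d` restricts to `j ≫ d = 0` on `E.X₁`, so it descends to the quotient
  -- `E.X₃`.
  let m : E.X₃ ⟶ J := hE.exact.desc (k ≫ d) (by rw [reassoc_of% hk, w])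
  have hm : E.g ≫ m = k ≫ d := hE.exact.g_desc _ _
  -- Whatever `E.g` kills comes from `E.X₁`, where `k` restricts to the monomorphism `j`.
  have hkg : Mono (biprod.lift k E.g) := Preadditive.mono_of_cancel_zero _ fun {W} x hx => by
    have h1 : x ≫ k = 0 := by simpa using hx =≫ biprod.fst
    have h2 : x ≫ E.g = 0 := by simpa using hx =≫ biprod.snd
    have h3 : hE.exact.lift x h2 ≫ E.f = x := hE.exact.lift_f x h2
    rw [← h3, Category.assoc, hk] at h1
    rw [← h3, zero_of_comp_mono j h1, zero_comp]
  have key : ∀ {W : D} (y : W ⟶ S.obj E.X₂), y ≫ S.map E.g = 0 →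
      ∃ x : W ⟶ S.obj E.X₁, y = x ≫ S.map E.f := fun {W} y hy => by
    have h1 : (y ≫ S.map k) ≫ S.map d = 0 := by
      rw [Category.assoc, ← S.map_comp, ← hm, S.map_comp, reassoc_of% hy, zero_comp]
    have : Mono ((ShortComplex.mk j d w).map S).f := ‹Mono (S.map j)›
    let x : W ⟶ S.obj E.X₁ := hj.lift (y ≫ S.map k) h1
    have hx : x ≫ S.map j = y ≫ S.map k := hj.lift_f _ h1
    refine ⟨x, ?_⟩
    have := hmono (biprod.lift k E.g)
    have hb : biprod.lift k E.g = k ≫ biprod.inl + E.g ≫ biprod.inr := by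
      apply biprod.hom_ext <;> simp
    have hf : E.f ≫ biprod.lift k E.g = j ≫ biprod.inl := by
      apply biprod.hom_ext <;> simp [hk]
    -- It is enough to compare `y` and `x ≫ S.map E.f` in $S(I\oplus X_3)$: their $I$-components
    -- agree by `hx` and their $X_3$-components vanish.
    rw [← cancel_mono (S.map (biprod.lift k E.g)), Category.assoc, ← S.map_comp, hf, hb, S.map_add,
      S.map_comp, S.map_comp, S.map_comp, Preadditive.comp_add, reassoc_of% hx, reassoc_of% hy,
      zero_comp, add_zero]
  rw [ShortComplex.exact_iff_exact_up_to_refinements]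
  intro W y hy
  obtain ⟨x, hx⟩ := key y hy
  exact ⟨W, 𝟙 W, inferInstance, x, (Category.id_comp _).trans hx⟩

lemma rightDerived_zero_preservesFiniteLimits [HasInjectiveResolutions C] (T : C ⥤ D)
    [T.Additive] : PreservesFiniteLimits (T.rightDerived 0) :=
  preservesFiniteLimits_of_exists_exact _ (exists_rightDerived_zero_exact T)

end ZerothDerived

variable (R : Type u) [Ring R]

/-! ### The adjunction between the tensor embedding and evaluation -/

section TensorEvaluation

open TensorProduct

variable {R}

/-- The additive map out of `X ⊗_R L` given by a balanced biadditive map. -/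
noncomputable def RTensor.lift {X L : Type u} [AddCommGroup X] [Module Rᵐᵒᵖ X] [AddCommGroup L]
    [Module R L] {G : Type*} [AddCommGroup G] (f : X →+ L →+ G)
    (h : ∀ (x : X) (r : R) (l : L), f (MulOpposite.op r • x) l = f x (r • l)) :
    RTensor R X L →+ G :=
  QuotientAddGroup.lift (tensorRel R X L)
    (TensorProduct.liftAddHom f fun n x l => by simp)
    ((AddSubgroup.closure_le _).2 (by
      rintro _ ⟨x, r, l, rfl⟩
      simp [AddMonoidHom.mem_ker, h]))

/-- The morphism `R ⟶ L` sending `1` to `l`. -/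
def regularTo {L : FPLMod R} (l : L.obj) : regular R ⟶ L :=
  ObjectProperty.homMk (ModuleCat.ofHom (LinearMap.toSpanSingleton R L.obj l))

lemma regularTo_add {L : FPLMod R} (l l' : L.obj) :
    regularTo (l + l') = regularTo l + regularTo l' := by
  apply ObjectProperty.hom_ext
  exact ModuleCat.hom_ext (LinearMap.ext fun x : R => smul_add x l l')

lemma regularTo_comp {L L' : FPLMod R} (l : L.obj) (g : L ⟶ L') :
    regularTo l ≫ g = regularTo (g.hom.hom l) := by
  apply ObjectProperty.hom_ext
  exact ModuleCat.hom_ext (LinearMap.ext fun x : R => map_smul g.hom.hom x l)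

lemma rightMul_regularTo {L : FPLMod R} (r : R) (l : L.obj) :
    rightMul R r ≫ regularTo l = regularTo (r • l) := by
  apply ObjectProperty.hom_ext
  exact ModuleCat.hom_ext (LinearMap.ext fun x : R => mul_smul x r l)

lemma regularTo_one : regularTo (L := regular R) (1 : R) = 𝟙 _ := rightMul_one R

lemma LFun.map_add_apply (G : LFun R) {L L' : FPLMod R} (f g : L ⟶ L') (x : G.obj.obj L) :
    G.obj.map (f + g) x = G.obj.map f x + G.obj.map g x := by
  rw [G.obj.map_add]; rfl

lemma LFun.map_comp_apply (G : LFun R) {L L' L'' : FPLMod R} (f : L ⟶ L') (g : L' ⟶ L'')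
    (x : G.obj.obj L) : G.obj.map (f ≫ g) x = G.obj.map g (G.obj.map f x) :=
  ConcreteCategory.congr_hom (G.obj.map_comp f g) x

/-- The additive map `G(R) ⊗_R L ⟶ G(L)`, `x ⊗ l ↦ G(1 ↦ l)(x)`. -/
noncomputable def tensorEval (G : LFun R) (L : FPLMod R) :
    RTensor R ((evR R).obj G) L.obj →+ G.obj.obj L :=
  RTensor.lift (X := (evR R).obj G)
    (AddMonoidHom.mk' (fun x : G.obj.obj (regular R) => AddMonoidHom.mk'
      (fun l => G.obj.map (regularTo l) x)
      fun l l' => by rw [regularTo_add, G.map_add_apply])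
      fun x y => by ext l; exact map_add (G.obj.map (regularTo l)).hom x y)
    fun (x : G.obj.obj (regular R)) r l => by
      change G.obj.map (regularTo l) (G.obj.map (rightMul R r) x) = G.obj.map (regularTo (r • l)) x
      rw [← G.map_comp_apply, rightMul_regularTo]

lemma tensorEval_rtmul (G : LFun R) (L : FPLMod R) (x : (evR R).obj G) (l : L.obj) :
    tensorEval G L (rtmul R x l) = G.obj.map (regularTo l) (show G.obj.obj (regular R) from x) :=
  rfl

variable (R)

/-- The canonical morphism `G(R) ⊗_R - ⟶ G`. -/
noncomputable def tensorCounit : evR R ⋙ t R ⟶ 𝟭 (LFun R) where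
  app G := ObjectProperty.homMk
    { app := fun L => AddCommGrpCat.ofHom (tensorEval G L)
      naturality := fun L L' g => AddCommGrpCat.hom_ext (RTensor.hom_ext fun x l => by
        refine (tensorEval_rtmul G L' x (g.hom.hom l)).trans ?_
        rw [← regularTo_comp]
        exact G.map_comp_apply (regularTo l) g x) }
  naturality G H α := by
    ext L : 4
    refine RTensor.hom_ext fun x l => ?_
    exact (ConcreteCategory.congr_hom (α.hom.naturality (regularTo l)) x).symm

/-- The tensor embedding is left adjoint to evaluation at `R`. -/
noncomputable def tensorAdj : t R ⊣ evR R :=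
  Adjunction.mkOfUnitCounit
    { unit := { app := toEvT R, naturality := fun X X' f => rfl }
      counit := tensorCounit R
      left_triangle := by
        ext X L : 6
        refine RTensor.hom_ext fun x l => ?_
        exact congrArg (rtmul R x) (one_smul R l)
      right_triangle := by
        ext G x
        change G.obj.map (regularTo (1 : R)) x = x
        rw [regularTo_one, G.obj.map_id]
        rfl }

end TensorEvaluation

/-! ### Exactness of `D_A` -/

instance : PreservesFiniteLimits (DA R) := rightDerived_zero_preservesFiniteLimits _

instance : (DA R).Additive := rightDerived_additive _ 0

instance : (DL R).Additive := leftDerived_additive _ 0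

/-- The Yoneda embedding is fully faithful. -/
def yonedaFPFullyFaithful : (yonedaFP R).FullyFaithful where
  preimage {X Y} f := (f.hom.app X.unop (𝟙 X.unop) : Y.unop ⟶ X.unop).op
  map_preimage {X Y} f := by
    ext A g
    refine (nat_apply f.hom (X := X.unop) g (𝟙 X.unop)).symm.trans ?_
    exact congrArg (f.hom.app A) (Category.id_comp (X := X.unop) g)
  preimage_map {X Y} f := Quiver.Hom.unop_inj (Category.comp_id f.unop)

instance : (yonedaFP R).Full := (yonedaFPFullyFaithful R).full

instance : (yonedaFP R).Faithful := (yonedaFPFullyFaithful R).faithful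

instance (X : RMod R) : IsIso (toW R X) := by
  have : IsIso ((Adjunction.ofIsRightAdjoint (yonedaFP R)).counit.app (op X)) := inferInstance
  exact inferInstanceAs (IsIso ((Adjunction.ofIsRightAdjoint (yonedaFP R)).counit.app (op X)).unop)

/-- The canonical morphism `t w ⟶ D_A`. -/
noncomputable def twToDA (F : (FPFun R)ᵒᵖ) : (t R).obj ((w R).obj F) ⟶ (DA R).obj F :=
  (w R ⋙ t R).toRightDerivedZero.app F

lemma twToDA_naturality {F G : (FPFun R)ᵒᵖ} (α : F ⟶ G) :
    (t R).map ((w R).map α) ≫ twToDA R G = twToDA R F ≫ (DA R).map α :=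
  (w R ⋙ t R).toRightDerivedZero.naturality α

lemma tToDA_eq (X : RMod R) : tToDA R X = (t R).map (toW R X) ≫ twToDA R _ := rfl

/-- Both factors are invertible: `toW` because Yoneda is fully faithful, the other because $(X,-)$
is projective, hence injective in the opposite category. -/
instance (X : RMod R) : IsIso (tToDA R X) := by
  have : IsIso (twToDA R (op ((yonedaFP R).obj (op X)))) := inferInstanceAs
    (IsIso ((w R ⋙ t R).toRightDerivedZero.app (op ((yonedaFP R).obj (op X)))))
  rw [tToDA_eq]
  infer_instance

lemma tToDA_naturality {X X' : RMod R} (f : X ⟶ X') :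
    (t R).map f ≫ tToDA R X' = tToDA R X ≫ (DA R).map ((yonedaFP R).map f.op).op := by
  have h : f ≫ toW R X' = toW R X ≫ (w R).map ((yonedaFP R).map f.op).op :=
    Quiver.Hom.op_inj (((Adjunction.ofIsRightAdjoint (yonedaFP R)).counit.naturality f.op).symm)
  rw [tToDA_eq, tToDA_eq, ← (t R).map_comp_assoc, h, (t R).map_comp_assoc, twToDA_naturality,
    Category.assoc]

/-- `t ≅ D_A Y`. -/
noncomputable def tIsoDA : t R ≅ (yonedaFP R).rightOp ⋙ DA R :=
  NatIso.ofComponents (fun X => asIso (tToDA R X)) fun f => tToDA_naturality R f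

/-! ### Yoneda's lemma for finitely presented functors, and presentations as exact sequences. -/

section
variable {R}

/-- The morphism `(X, -) ⟶ F` corresponding to an element of `F(X)`. -/
def FPFun.ofElem (F : FPFun R) {X : RMod R} (e : F.obj.obj X) : (yonedaFP R).obj (op X) ⟶ F :=
  ObjectProperty.homMk (AGJ.ofElem F.obj e)

lemma FPFun.yoneda_hom_ext {F : FPFun R} {X : RMod R} {α β : (yonedaFP R).obj (op X) ⟶ F}
    (h : α.hom.app X (𝟙 X) = β.hom.app X (𝟙 X)) : α = β := by
  ext A g
  have h' := fun γ : (yonedaFP R).obj (op X) ⟶ F =>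
    (congrArg (γ.hom.app A) (Category.id_comp (X := X) g)).symm.trans (nat_apply γ.hom g (𝟙 X))
  exact (h' α).trans ((congrArg (F.obj.map g) h).trans (h' β).symm)

lemma FPFun.ofElem_injective (F : FPFun R) {X : RMod R} {e e' : F.obj.obj X}
    (h : F.ofElem e = F.ofElem e') : e = e' := by
  have h₁ := ConcreteCategory.congr_hom (F.obj.map_id X)
  have h₂ : F.obj.map (𝟙 X) e = F.obj.map (𝟙 X) e' :=
    congrArg (fun β : (yonedaFP R).obj (op X) ⟶ F => β.hom.app X (𝟙 X)) h
  exact (h₁ e).symm.trans (h₂.trans (h₁ e'))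

lemma FPFun.ofElem_comp {F G : FPFun R} {X : RMod R} (e : F.obj.obj X) (α : F ⟶ G) :
    F.ofElem e ≫ α = G.ofElem (α.hom.app X e) := by
  ext A g
  exact nat_apply α.hom (X := X) g e

lemma FPFun.map_comp_ofElem (F : FPFun R) {X Y : RMod R} (f : X ⟶ Y) (e : F.obj.obj X) :
    (yonedaFP R).map f.op ≫ F.ofElem e = F.ofElem (F.obj.map f e) := by
  ext A g
  exact map_comp_apply F.obj f g e

/-- The cokernel property is checked directly: a morphism $(X,-)\to G$ amounts to an element of
$G(X)$, composing it with $(f,-)$ applies $G(f)$ to that element, and elements killed by $G(f)$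
descend by `Presents.exists_desc`. -/
lemma Presents.exact {F : FPFun R} {X Y : RMod R} {f : X ⟶ Y} {e : F.obj.obj X}
    (h : Presents F.obj f e) : ∃ w : (yonedaFP R).map f.op ≫ F.ofElem e = 0,
      (ShortComplex.mk _ _ w).Exact ∧ Epi (F.ofElem e) := by
  have w : (yonedaFP R).map f.op ≫ F.ofElem e = 0 := by
    rw [FPFun.map_comp_ofElem, (h.rel f).2 ⟨𝟙 Y, (Category.comp_id f).symm⟩]
    ext A g
    exact map_zero (F.obj.map g).hom
  refine ⟨w, (ShortComplex.exact_and_epi_g_iff_g_is_cokernel _).2 ⟨?_⟩⟩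
  have hd : ∀ {G : FPFun R} (k : (yonedaFP R).obj (op X) ⟶ G), (yonedaFP R).map f.op ≫ k = 0 →
      ∃ α : F ⟶ G, F.ofElem e ≫ α = k := fun {G} k hk => by
    have hx : G.obj.map f (k.hom.app X (𝟙 X)) = 0 := by
      refine (nat_apply k.hom (X := X) f (𝟙 X)).symm.trans ?_
      have h0 : k.hom.app Y (f ≫ 𝟙 Y) = 0 :=
        congrArg (fun β : (yonedaFP R).obj (op Y) ⟶ G => β.hom.app Y (𝟙 Y)) hk
      refine (congrArg (k.hom.app Y) ?_).trans h0
      exact (Category.id_comp f).trans (Category.comp_id f).symm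
    obtain ⟨α, hα⟩ := h.exists_desc (G := G.obj) _ hx
    refine ⟨ObjectProperty.homMk α, ?_⟩
    rw [FPFun.ofElem_comp]
    apply FPFun.yoneda_hom_ext
    refine (congrArg (G.obj.map (𝟙 X)) hα).trans ?_
    exact (ConcreteCategory.congr_hom (G.obj.map_id X) (k.hom.app X (𝟙 X)))
  exact CokernelCofork.IsColimit.ofπ _ _ (fun k hk => (hd k hk).choose)
    (fun k hk => (hd k hk).choose_spec) fun k hk m hm => by
      apply ObjectProperty.hom_ext
      apply h.hom_ext
      have h1 : F.ofElem e ≫ m = F.ofElem e ≫ (hd k hk).choose :=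
        hm.trans (hd k hk).choose_spec.symm
      rw [FPFun.ofElem_comp, FPFun.ofElem_comp] at h1
      exact FPFun.ofElem_injective _ h1

end

lemma DA_exact {S : ShortComplex (FPFun R)} (h : S.Exact) (hg : Epi S.g) :
    (S.op.map (DA R)).Exact ∧ Mono ((DA R).map S.g.op) := by
  have hl : PreservesFiniteLimits (DA R) := inferInstance
  have H := ((DA R).preservesFiniteLimits_tfae.out 3 1).1 hl
  exact H S.op ⟨h.op, inferInstanceAs (Mono S.g.op)⟩

/-- Together with `Presents.mono_DA`, this makes $D_A F$ the kernel of $D_A(X,-)\to D_A(Y,-)$. -/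
lemma Presents.DA_lift {F : FPFun R} {X Y : RMod R} {f : X ⟶ Y} {e : F.obj.obj X}
    (h : Presents F.obj f e) {W : LFun R} (x : W ⟶ (DA R).obj (op ((yonedaFP R).obj (op X))))
    (hx : x ≫ (DA R).map ((yonedaFP R).map f.op).op = 0) :
    ∃ y : W ⟶ (DA R).obj (op F), y ≫ (DA R).map (F.ofElem e).op = x := by
  obtain ⟨w, hw, he⟩ := h.exact
  obtain ⟨h₁, h₂⟩ := DA_exact R hw he
  have : Mono ((ShortComplex.mk _ _ w).op.map (DA R)).f := h₂
  exact ⟨h₁.lift x hx, h₁.lift_f x hx⟩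

lemma Presents.mono_DA {F : FPFun R} {X Y : RMod R} {f : X ⟶ Y} {e : F.obj.obj X}
    (h : Presents F.obj f e) : Mono ((DA R).map (F.ofElem e).op) := by
  obtain ⟨w, hw, he⟩ := h.exact
  exact (DA_exact R hw he).2

/-- This says that $\ker l\to\ker r$ is an epimorphism. The pair $(x,0)$ dies in $X_4$, so by
exactness of $X_1\to X_2\oplus X_3\to X_4$ it comes, after a refinement, from $X_1$. -/
lemma _root_.CategoryTheory.IsPushout.exists_lift_up_to_refinements {C : Type*} [Category* C]
    [Abelian C] {X₁ X₂ X₃ X₄ : C} {t : X₁ ⟶ X₂} {l : X₁ ⟶ X₃} {r : X₂ ⟶ X₄} {b : X₃ ⟶ X₄}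
    (h : IsPushout t l r b) {W : C} (x : W ⟶ X₂) (hx : x ≫ r = 0) :
    ∃ (W' : C) (π : W' ⟶ W) (_ : Epi π) (a : W' ⟶ X₁), π ≫ x = a ≫ t ∧ a ≫ l = 0 := by
  obtain ⟨W', π, hπ, (a : W' ⟶ X₁), ha⟩ := h.exact_shortComplex.exact_up_to_refinements (x ≫ biprod.inl)
    (by simp only [CommSq.shortComplex, Category.assoc, biprod.inl_desc, hx]; rfl)
  replace ha : π ≫ x ≫ biprod.inl = a ≫ biprod.lift t (-l) := ha
  refine ⟨W', π, hπ, a, ?_, ?_⟩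
  · have h₁ := ha =≫ biprod.fst
    rw [Category.assoc, Category.assoc, biprod.inl_fst, Category.comp_id, Category.assoc] at h₁
    exact h₁.trans (congrArg (a ≫ ·) (biprod.lift_fst _ _))
  · have h₂ := ha =≫ biprod.snd
    rw [Category.assoc, Category.assoc, biprod.inl_snd, comp_zero, comp_zero, Category.assoc] at h₂
    have h₃ := h₂.trans (congrArg (a ≫ ·) (biprod.lift_snd _ _))
    simpa using h₃.symm

/-- Compatible presentations turn the map into one between kernels of opposite sides of a pushout
square, and such a map is epi. -/
lemma DA_epi {F G : FPFun R} (i : F ⟶ G) [Mono i] : Epi ((DA R).map i.op) := by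
  obtain ⟨X, Y, f, e, hf⟩ := F.exists_presents
  obtain ⟨A, B, g, c, hg⟩ := G.exists_presents
  obtain ⟨u, hu⟩ := hg.gen (i.hom.app X e)
  have hi : ∀ T, Function.Injective (i.hom.app T) := fun T => by
    have : (isFinPresFunctor R).ι.PreservesMonomorphisms :=
      ObjectProperty.preservesMonomorphisms_ι_of_isNormalEpiCategory _
    have : Mono i.hom := inferInstanceAs (Mono ((isFinPresFunctor R).ι.map i))
    exact (AddCommGrpCat.mono_iff_injective _).1 ((NatTrans.mono_iff_mono_app i.hom).1 this T)
  -- Since `i` is injective, `h` kills `e` exactly when `u ≫ h` kills `c`, that is, when `u ≫ h`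
  -- factors through `g`; this means that `h` extends to the pushout.
  have hP : Presents F.obj (pushout.inl u g) e := ⟨hf.gen, fun {T} h => by
    rw [← map_eq_zero_iff _ (hi T), nat_apply, ← hu, ← map_comp_apply, hg.rel]
    constructor
    · rintro ⟨k, hk⟩
      exact ⟨pushout.desc h k hk, (pushout.inl_desc _ _ _).symm⟩
    · rintro ⟨k, rfl⟩
      exact ⟨pushout.inr u g ≫ k, by rw [pushout.condition_assoc]⟩⟩
  have hsq : i.op ≫ (F.ofElem e).op = (G.ofElem c).op ≫ ((yonedaFP R).map u.op).op := by
    apply Quiver.Hom.unop_inj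
    exact (FPFun.ofElem_comp e i).trans ((congrArg G.ofElem hu).symm.trans
      (G.map_comp_ofElem u c).symm)
  -- The pushout survives in $(\mathrm{mod}(R^{op}),\mathrm{Ab})$ because $D_A\mathsf Y\cong t$ and
  -- `t` is a left adjoint.
  have : PreservesColimitsOfSize.{0, 0} (t R) := (tensorAdj R).leftAdjoint_preservesColimits
  let D' := (yonedaFP R).rightOp ⋙ DA R
  have : PreservesColimitsOfShape WalkingSpan D' := preservesColimitsOfShape_of_natIso (tIsoDA R)
  have hpo : IsPushout (D'.map u) (D'.map g) (D'.map (pushout.inl u g)) (D'.map (pushout.inr u g)) :=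
    (IsPushout.of_hasPushout u g).map D'
  have hm := hP.mono_DA R
  rw [epi_iff_surjective_up_to_refinements]
  intro W y
  obtain ⟨w, hw, he⟩ := hP.exact
  let x : W ⟶ D'.obj X := y ≫ (DA R).map (F.ofElem e).op
  have hx : x ≫ D'.map (pushout.inl u g) = 0 := by
    have h0 : (F.ofElem e).op ≫ ((yonedaFP R).map (pushout.inl u g).op).op = 0 :=
      congrArg Quiver.Hom.op w
    change (y ≫ (DA R).map (F.ofElem e).op) ≫
      (DA R).map ((yonedaFP R).map (pushout.inl u g).op).op = 0
    rw [Category.assoc, ← (DA R).map_comp, h0, (DA R).map_zero, comp_zero]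
  -- Here `x` lies in the kernel on the $F$ side; `a` is a lift to the kernel on the $G$ side, hence
  -- a generalized element of $D_A G$.
  obtain ⟨W', π, hπ, a, h1, h2⟩ := hpo.exists_lift_up_to_refinements x hx
  obtain ⟨b, hb⟩ := hg.DA_lift R a h2
  refine ⟨W', π, hπ, b, ?_⟩
  rw [← cancel_mono ((DA R).map (F.ofElem e).op), Category.assoc, Category.assoc, ← (DA R).map_comp,
    hsq, (DA R).map_comp, reassoc_of% hb]
  exact h1

instance : PreservesFiniteColimits (DA R) := by
  refine ((DA R).preservesFiniteColimits_tfae.out 0 3).1 fun S hS => ?_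
  have := hS.mono_f
  have : Epi S.g := hS.epi_g
  have hl : PreservesFiniteLimits (DA R) := inferInstance
  have H := ((DA R).preservesFiniteLimits_tfae.out 3 0).1 hl
  exact ⟨(H S hS).1, DA_epi R S.g.unop⟩

/-! ### Injective objects of `(mod(Rᵒᵖ), Ab)` are tensor functors -/

section
variable {R}

/-- The functor `(L, -)` on finitely presented left modules. -/
def corep (L : FPLMod R) : LFun R := AdditiveFunctor.of (preadditiveCoyoneda.obj (op L))

/-- The natural transformation `(L', -) ⟶ (L, -)` given by `f : L ⟶ L'`. -/
def corepMap {L L' : FPLMod R} (f : L ⟶ L') : corep L' ⟶ corep L :=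
  ObjectProperty.homMk (preadditiveCoyoneda.map f.op)

lemma LFun.map_zero_apply (G : LFun R) {L L' : FPLMod R} (x : G.obj.obj L) :
    G.obj.map (0 : L ⟶ L') x = 0 := by
  rw [G.obj.map_zero]; rfl

lemma LFun.map_id_apply (G : LFun R) {L : FPLMod R} (x : G.obj.obj L) :
    G.obj.map (𝟙 L) x = x := ConcreteCategory.congr_hom (G.obj.map_id L) x

lemma LFun.nat_apply {G H : LFun R} (α : G ⟶ H) {L L' : FPLMod R} (f : L ⟶ L')
    (x : G.obj.obj L) : α.hom.app L' (G.obj.map f x) = H.obj.map f (α.hom.app L x) :=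
  ConcreteCategory.congr_hom (α.hom.naturality f) x

/-- The natural transformation `(L, -) ⟶ G` corresponding to an element of `G(L)`. -/
def LFun.ofElem (G : LFun R) {L : FPLMod R} (x : G.obj.obj L) : corep L ⟶ G :=
  ObjectProperty.homMk
    { app := fun M => AddCommGrpCat.ofHom
        { toFun := fun g : L ⟶ M => G.obj.map g x
          map_zero' := G.map_zero_apply x
          map_add' := fun f g => G.map_add_apply f g x }
      naturality := fun M N h => by
        ext g
        exact G.map_comp_apply g h x }

lemma LFun.corepMap_ofElem (G : LFun R) {L L' : FPLMod R} (f : L ⟶ L') (x : G.obj.obj L) :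
    corepMap f ≫ G.ofElem x = G.ofElem (G.obj.map f x) := by
  ext M g
  exact G.map_comp_apply f g x

lemma LFun.ofElem_elem {G : LFun R} {L : FPLMod R} (α : corep L ⟶ G) :
    G.ofElem (α.hom.app L (𝟙 L)) = α := by
  ext M g
  exact (LFun.nat_apply α (L := L) g (𝟙 L)).symm.trans
    (congrArg (α.hom.app M) (Category.id_comp (X := L) g))

lemma LFun.ofElem_apply_id (G : LFun R) {L : FPLMod R} (x : G.obj.obj L) :
    (G.ofElem x).hom.app L (𝟙 L) = x := G.map_id_apply x

/-- An injective object of `(mod(Rᵒᵖ), Ab)` sends cokernels to right exact sequences. -/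
lemma Injective.exists_map_eq (I : LFun R) [Injective I] {K L L' : FPLMod R} (q : K ⟶ L)
    (p : L ⟶ L') (h : ∀ {M : FPLMod R} (g : L ⟶ M), q ≫ g = 0 → ∃ k, g = p ≫ k) (w : q ≫ p = 0)
    (y : I.obj.obj L) (hy : I.obj.map p y = 0) : ∃ z, I.obj.map q z = y := by
  have w' : corepMap p ≫ corepMap q = 0 := by
    ext M g
    exact (Category.assoc q p (show L' ⟶ M from g)).symm.trans ((w =≫ _).trans zero_comp)
  -- Exactness is tested on the composite kernel → cokernel: an element of the kernel is a map `g`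
  -- with `q ≫ g = 0`, so it factors through `p` and vanishes in the cokernel.
  have hS : (ShortComplex.mk _ _ w').Exact := by
    rw [ShortComplex.exact_iff_kernel_ι_comp_cokernel_π_zero]
    ext M x
    have h1 : q ≫ (kernel.ι (corepMap q)).hom.app M x = 0 :=
      congrArg (fun β : _ ⟶ corep K => β.hom.app M x) (kernel.condition (corepMap q))
    obtain ⟨k, hk⟩ := h _ h1
    have h2 := congrArg (fun β : corep L' ⟶ _ => β.hom.app M k) (cokernel.condition (corepMap p))
    exact (congrArg ((cokernel.π (corepMap p)).hom.app M) hk).trans h2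
  have hy' : corepMap p ≫ I.ofElem y = 0 := by
    rw [LFun.corepMap_ofElem, hy]
    ext M g
    exact map_zero (I.obj.map g).hom
  -- Applying $\mathrm{Nat}(-,I)$ to this exact sequence and evaluating at identities yields the
  -- preimage.
  let z := hS.descToInjective (I.ofElem y) hy'
  have hz : corepMap q ≫ z = I.ofElem y := hS.comp_descToInjective _ hy'
  refine ⟨z.hom.app K (𝟙 K), ?_⟩
  rw [← LFun.ofElem_elem z, LFun.corepMap_ofElem] at hz
  rw [← I.ofElem_apply_id y, ← hz, I.ofElem_apply_id]

/-- For `p` epi, $(L',-)\to(L,-)$ is mono, so the morphism given by an element of $I(L')$ extends to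
$(L,-)$; the extension is an element of $I(L)$. -/
lemma Injective.map_surjective (I : LFun R) [Injective I] {L L' : FPLMod R}
    (p : L ⟶ L') [Epi p] : Function.Surjective (I.obj.map p) := by
  intro x
  have : Mono (corepMap p) := Preadditive.mono_of_cancel_zero _ fun {G} α hα => by
    ext M a
    have h : p ≫ (α.hom.app M a : L' ⟶ M) = 0 := congrArg (fun β : G ⟶ _ => β.hom.app M a) hα
    exact zero_of_epi_comp p h
  have h := Injective.comp_factorThru (I.ofElem x) (corepMap p)
  rw [← LFun.ofElem_elem (Injective.factorThru (I.ofElem x) (corepMap p)),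
    LFun.corepMap_ofElem] at h
  exact ⟨_, ((I.ofElem_apply_id _).symm.trans (congrArg (fun β : corep L' ⟶ I =>
    β.hom.app L' (𝟙 L')) h)).trans (I.ofElem_apply_id x)⟩

/-- The free left module of rank `n`. -/
def freeL (R : Type u) [Ring R] (n : ℕ) : FPLMod R :=
  ⟨ModuleCat.of R (Fin n → R), inferInstanceAs (Module.FinitePresentation R (Fin n → R))⟩

/-- The coordinate projections of a free module. -/
def freeL.proj {n : ℕ} (i : Fin n) : freeL R n ⟶ regular R :=
  ObjectProperty.homMk (ModuleCat.ofHom (LinearMap.proj i))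

/-- The standard basis of a free module. -/
def freeL.basis {n : ℕ} (i : Fin n) : (freeL R n).obj := (Pi.single i 1 : Fin n → R)

/-- The coordinate inclusions of a free module. -/
def freeL.incl {n : ℕ} (i : Fin n) : regular R ⟶ freeL R n := regularTo (freeL.basis i)

/-- A linear map, as a morphism of `mod(Rᵒᵖ)`. -/
def ofLinear {L L' : FPLMod R} (f : L.obj →ₗ[R] L'.obj) : L ⟶ L' :=
  ObjectProperty.homMk (ModuleCat.ofHom f)

lemma freeL.total (n : ℕ) : ∑ i, freeL.proj (R := R) i ≫ freeL.incl i = 𝟙 (freeL R n) := by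
  have h : ∀ s : Finset (Fin n),
      (∑ i ∈ s, freeL.proj (R := R) i ≫ freeL.incl i).hom.hom =
        ∑ i ∈ s, LinearMap.single R (fun _ => R) i ∘ₗ LinearMap.proj i := fun s => by
    induction s using Finset.induction_on with
    | empty => rfl
    | insert i s hi ih =>
      rw [Finset.sum_insert hi, Finset.sum_insert hi, ← ih]
      refine congrArg (· + (∑ i ∈ s, freeL.proj (R := R) i ≫ freeL.incl i).hom.hom) ?_
      refine LinearMap.ext fun x => funext fun j => ?_
      change x i * (Pi.single i 1 : Fin n → R) j = (Pi.single i (x i) : Fin n → R) j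
      simp [Pi.single_apply]
  apply ObjectProperty.hom_ext
  refine ModuleCat.hom_ext ((h _).trans ?_)
  refine LinearMap.ext fun (x : Fin n → R) => funext fun j => ?_
  rw [LinearMap.sum_apply, Finset.sum_apply]
  refine Eq.trans ?_ (Finset.sum_ite_eq Finset.univ j x |>.trans (if_pos (Finset.mem_univ j)))
  simp [Pi.single_apply]

lemma freeL.incl_proj {n : ℕ} (i : Fin n) : freeL.incl (R := R) i ≫ freeL.proj i = 𝟙 _ := by
  rw [freeL.incl, regularTo_comp, ← regularTo_one]
  exact congrArg regularTo (Pi.single_eq_same (M := fun _ => R) i 1)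

lemma freeL.incl_proj_of_ne {n : ℕ} {i k : Fin n} (h : k ≠ i) :
    freeL.incl (R := R) k ≫ freeL.proj i = 0 := by
  rw [freeL.incl, regularTo_comp]
  refine (congrArg regularTo (Pi.single_eq_of_ne (M := fun _ => R) h.symm 1)).trans ?_
  apply ObjectProperty.hom_ext
  exact ModuleCat.hom_ext (LinearMap.ext fun x : R => mul_zero x)

lemma LFun.map_sum_apply (G : LFun R) {L L' : FPLMod R} {ι : Type*} (s : Finset ι)
    (f : ι → (L ⟶ L')) (x : G.obj.obj L) :
    G.obj.map (∑ i ∈ s, f i) x = ∑ i ∈ s, G.obj.map (f i) x :=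
  map_sum (AddMonoidHom.mk' (fun g : L ⟶ L' => G.obj.map g x)
    fun f g => G.map_add_apply f g x) f s

/-- Combined with `LFun.free_total`, this identifies $G(R^n)$ with $G(R)^n$, by additivity alone. -/
lemma LFun.map_proj_sum (G : LFun R) {n : ℕ} (x : Fin n → G.obj.obj (regular R)) (i : Fin n) :
    G.obj.map (freeL.proj i) (∑ k, G.obj.map (freeL.incl k) (x k)) = x i := by
  rw [map_sum, Finset.sum_eq_single i, ← G.map_comp_apply, freeL.incl_proj, G.map_id_apply]
  · intro k _ hk
    rw [← G.map_comp_apply, freeL.incl_proj_of_ne hk, G.map_zero_apply]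
  · exact fun h => absurd (Finset.mem_univ i) h

lemma LFun.free_total (G : LFun R) {n : ℕ} (y : G.obj.obj (freeL R n)) :
    y = ∑ i, G.obj.map (freeL.incl i) (G.obj.map (freeL.proj i) y) := by
  refine (G.map_id_apply y).symm.trans ?_
  rw [← freeL.total, G.map_sum_apply]
  simp only [G.map_comp_apply]

@[elab_as_elim]
lemma RTensor.induction {X L : Type u} [AddCommGroup X] [Module Rᵐᵒᵖ X] [AddCommGroup L]
    [Module R L] {P : RTensor R X L → Prop} (z : RTensor R X L) (zero : P 0)
    (tmul : ∀ x l, P (rtmul R x l)) (add : ∀ a b, P a → P b → P (a + b)) : P z := by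
  obtain ⟨z, rfl⟩ := QuotientAddGroup.mk'_surjective (tensorRel R X L) z
  induction z with
  | zero => exact zero
  | tmul x l => exact tmul x l
  | add a b ha hb => exact add _ _ ha hb

/-- `x ↦ x ⊗ l`, as an additive map. -/
def rtmulLeft {X L : Type u} [AddCommGroup X] [Module Rᵐᵒᵖ X] [AddCommGroup L]
    [Module R L] (l : L) : X →+ RTensor R X L :=
  AddMonoidHom.mk' (fun x => rtmul R x l) fun x x' => add_rtmul x x' l

/-- `l ↦ x ⊗ l`, as an additive map. -/
def rtmulRight {X L : Type u} [AddCommGroup X] [Module Rᵐᵒᵖ X] [AddCommGroup L]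
    [Module R L] (x : X) : L →+ RTensor R X L :=
  AddMonoidHom.mk' (fun l => rtmul R x l) fun l l' => rtmul_add x l l'

lemma sum_rtmul {X L : Type u} [AddCommGroup X] [Module Rᵐᵒᵖ X] [AddCommGroup L]
    [Module R L] {ι : Type*} (s : Finset ι) (x : ι → X) (l : L) :
    rtmul R (∑ i ∈ s, x i) l = ∑ i ∈ s, rtmul R (x i) l :=
  map_sum (rtmulLeft l) x s

lemma rtmul_sum {X L : Type u} [AddCommGroup X] [Module Rᵐᵒᵖ X] [AddCommGroup L]
    [Module R L] {ι : Type*} (s : Finset ι) (x : X) (l : ι → L) :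
    rtmul R x (∑ i ∈ s, l i) = ∑ i ∈ s, rtmul R x (l i) :=
  map_sum (rtmulRight x) l s

lemma linearMap_eq_sum {L : Type u} [AddCommGroup L] [Module R L] {n : ℕ}
    (φ : (Fin n → R) →ₗ[R] L) (v : Fin n → R) : φ v = ∑ i, v i • φ (Pi.single i 1) := by
  rw [LinearMap.pi_apply_eq_sum_univ φ v]
  refine Finset.sum_congr rfl fun i _ => congrArg (v i • φ ·) (funext fun j => ?_)
  simp [Pi.single_apply, eq_comm]

/-- The coefficients of a lift of $l$ to $R^n$ are moved across the tensor sign onto $x$. -/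
lemma RTensor.exists_sum {X L : Type u} [AddCommGroup X] [Module Rᵐᵒᵖ X] [AddCommGroup L]
    [Module R L] {n : ℕ} (φ : (Fin n → R) →ₗ[R] L) (hφ : Function.Surjective φ)
    (z : RTensor R X L) : ∃ x : Fin n → X, z = ∑ i, rtmul R (x i) (φ (Pi.single i 1)) := by
  induction z using RTensor.induction with
  | zero => exact ⟨0, (Finset.sum_eq_zero fun i _ => map_zero (rtmulLeft _)).symm⟩
  | tmul x l =>
    obtain ⟨v, rfl⟩ := hφ l
    refine ⟨fun i => MulOpposite.op (v i) • x, ?_⟩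
    rw [linearMap_eq_sum φ v, rtmul_sum]
    exact Finset.sum_congr rfl fun i _ => (rtmul_smul x (v i) _).symm
  | add a b ha hb =>
    obtain ⟨x, rfl⟩ := ha
    obtain ⟨y, rfl⟩ := hb
    refine ⟨x + y, ?_⟩
    rw [← Finset.sum_add_distrib]
    exact Finset.sum_congr rfl fun i _ => (add_rtmul _ _ _).symm

lemma tensorEval_sum (G : LFun R) {n : ℕ} {L : FPLMod R} (φ : (Fin n → R) →ₗ[R] L.obj)
    (x : Fin n → (evR R).obj G) :
    tensorEval G L (∑ i, rtmul R (x i) (φ (Pi.single i 1))) =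
      G.obj.map (ofLinear (L := freeL R n) φ) (∑ i, G.obj.map (freeL.incl i) (x i)) := by
  rw [map_sum, map_sum]
  refine Finset.sum_congr rfl fun i _ => ?_
  refine Eq.trans ?_ (G.map_comp_apply (freeL.incl i) (ofLinear φ) (x i))
  rw [freeL.incl, regularTo_comp]
  rfl

/-- An Eilenberg-Watts argument: source and target agree on free modules of finite rank and are
right exact, so a presentation $R^m\to R^n\to L\to 0$ decides the matter. It is carried out with
elements. -/
lemma tensorEval_bijective (I : LFun R) [Injective I] (L : FPLMod R) :
    Function.Bijective (tensorEval I L) := by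
  have hL : Module.FinitePresentation R L.obj := L.property
  obtain ⟨n, φ, hφ⟩ := Module.Finite.exists_fin' R L.obj
  let p : freeL R n ⟶ L := ofLinear (L := freeL R n) φ
  constructor
  · rw [injective_iff_map_eq_zero]
    intro z hz
    obtain ⟨x, rfl⟩ := RTensor.exists_sum (X := (evR R).obj I) φ hφ z
    obtain ⟨m, ψ, hψ⟩ := (Submodule.fg_iff_exists_fin_linearMap _ _).1
      (Module.FinitePresentation.fg_ker φ hφ)
    let q : freeL R m ⟶ freeL R n := ofLinear (L := freeL R m) (L' := freeL R n) ψ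
    have hφψ : ∀ v, φ (ψ v) = 0 := fun v => by
      have : ψ v ∈ LinearMap.ker φ := hψ ▸ LinearMap.mem_range_self ψ v
      exact this
    have w : q ≫ p = 0 := by
      apply ObjectProperty.hom_ext
      exact ModuleCat.hom_ext (LinearMap.ext hφψ)
    obtain ⟨y, hy⟩ := Injective.exists_map_eq I q p (fun {M} g hg => by
      have hg' : LinearMap.ker φ ≤ LinearMap.ker g.hom.hom := by
        rw [← hψ]
        rintro _ ⟨v, rfl⟩
        exact congrArg (fun k : freeL R m ⟶ M => k.hom.hom v) hg
      let k : L.obj →ₗ[R] M.obj :=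
        (LinearMap.ker φ).liftQ g.hom.hom hg' ∘ₗ (φ.quotKerEquivOfSurjective hφ).symm.toLinearMap
      refine ⟨ofLinear k, ?_⟩
      apply ObjectProperty.hom_ext
      refine ModuleCat.hom_ext (LinearMap.ext fun v => ?_)
      have : (φ.quotKerEquivOfSurjective hφ).symm (φ v) = Submodule.Quotient.mk v :=
        (LinearEquiv.symm_apply_eq _).2 rfl
      change _ = (LinearMap.ker φ).liftQ g.hom.hom hg' ((φ.quotKerEquivOfSurjective hφ).symm (φ v))
      rw [this]
      rfl) w _ ((tensorEval_sum I φ x).symm.trans hz)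
    let y' : Fin m → (evR R).obj I := fun j => I.obj.map (freeL.proj j) y
    -- The element $(x_i)$ of $I(R^n)$ dies in $I(L)$, so it is the image of some $y\in I(R^m)$;
    -- these are its coordinates in terms of the matrix of $\psi$.
    have hx : ∀ i, x i = ∑ j, MulOpposite.op (ψ (Pi.single j 1) i) • y' j := fun i => by
      have h1 := I.map_proj_sum x i
      have h2 := I.free_total y
      rw [h2, map_sum] at hy
      refine h1.symm.trans ((congrArg (I.obj.map (freeL.proj i)) hy.symm).trans ?_)
      rw [map_sum]
      refine Finset.sum_congr rfl fun j _ => ?_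
      rw [← I.map_comp_apply, ← I.map_comp_apply, freeL.incl, regularTo_comp]
      rfl
    -- Moving the matrix entries to the right factor leaves the tensors
    -- $y_j\otimes\varphi(\psi(e_j))$, which are zero.
    calc ∑ i, rtmul R (x i) (φ (Pi.single i 1))
        = ∑ i, ∑ j, rtmul R (y' j) (ψ (Pi.single j 1) i • φ (Pi.single i 1)) := by
          refine Finset.sum_congr rfl fun i _ => ?_
          rw [hx i, sum_rtmul]
          exact Finset.sum_congr rfl fun j _ => rtmul_smul _ _ _
      _ = ∑ j, rtmul R (y' j) (φ (ψ (Pi.single j 1))) := by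
          rw [Finset.sum_comm]
          refine Finset.sum_congr rfl fun j _ => ?_
          rw [← rtmul_sum, ← linearMap_eq_sum]
      _ = 0 := Finset.sum_eq_zero fun j _ => by
          rw [hφψ]
          exact map_zero (rtmulRight (y' j))
  · intro x
    have : Epi p := Preadditive.epi_of_cancel_zero _ fun {M} g hg => by
      apply ObjectProperty.hom_ext
      refine ModuleCat.hom_ext (LinearMap.ext fun l => ?_)
      obtain ⟨v, rfl⟩ := hφ l
      exact congrArg (fun k : freeL R n ⟶ M => k.hom.hom v) hg
    obtain ⟨y, rfl⟩ := Injective.map_surjective I p x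
    refine ⟨_, (tensorEval_sum I φ fun i => I.obj.map (freeL.proj i) y).trans ?_⟩
    rw [← I.free_total y]

instance (I : LFun R) [Injective I] : IsIso ((tensorCounit R).app I) := by
  have : ∀ L, IsIso (((tensorCounit R).app I).hom.app L) := fun L =>
    (ConcreteCategory.isIso_iff_bijective _).2 (tensorEval_bijective I L)
  have : IsIso ((ObjectProperty.ι _).map ((tensorCounit R).app I)) :=
    NatIso.isIso_of_isIso_app ((tensorCounit R).app I).hom
  exact isIso_of_reflects_iso _ (ObjectProperty.ι _)

end

/-! ### The isomorphism `D_A D_L ≅ 1` -/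

/-- The canonical morphism `D_L ⟶ Y ev_R`. -/
noncomputable def fromDL (G : LFun R) :
    (DL R).obj (op G) ⟶ (yonedaFP R).obj (op ((evR R).obj G)) :=
  (YevR R).fromLeftDerivedZero.app (op G)

lemma fromDL_naturality {G H : LFun R} (v : G ⟶ H) :
    (DL R).map v.op ≫ fromDL R G = fromDL R H ≫ (yonedaFP R).map ((evR R).map v).op :=
  (YevR R).fromLeftDerivedZero.naturality v.op

instance (I : LFun R) [Injective I] : IsIso (fromDL R I) := by
  have h : ∀ (P : (LFun R)ᵒᵖ) [Projective P], IsIso ((YevR R).fromLeftDerivedZero.app P) :=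
    fun P _ => inferInstance
  exact h (op I)

/-- `D_A D_L`, as a covariant functor. -/
noncomputable abbrev DADL : LFun R ⥤ LFun R := (DL R).rightOp ⋙ DA R

/-- The canonical morphism `G(R) ⊗ - ⟶ D_A D_L G`. -/
noncomputable def tensorToDADL (G : LFun R) : (t R).obj ((evR R).obj G) ⟶ (DADL R).obj G :=
  tToDA R ((evR R).obj G) ≫ (DA R).map (fromDL R G).op

lemma tensorToDADL_naturality {G H : LFun R} (v : G ⟶ H) :
    (t R).map ((evR R).map v) ≫ tensorToDADL R H = tensorToDADL R G ≫ (DADL R).map v := by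
  have h : ((yonedaFP R).map ((evR R).map v).op).op ≫ (fromDL R H).op =
      (fromDL R G).op ≫ ((DL R).map v.op).op :=
    congrArg Quiver.Hom.op (fromDL_naturality R v).symm
  simp only [tensorToDADL, Category.assoc]
  rw [← Category.assoc, tToDA_naturality, Category.assoc, ← (DA R).map_comp, h, (DA R).map_comp]
  rfl

instance (I : LFun R) [Injective I] : IsIso (tensorToDADL R I) := by
  dsimp only [tensorToDADL]
  infer_instance

/-- The isomorphism `D_A D_L I ≅ I` for injective `I`. -/
noncomputable def unitInj (I : LFun R) [Injective I] : (DADL R).obj I ⟶ I :=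
  inv (tensorToDADL R I) ≫ (tensorCounit R).app I

lemma tensorToDADL_unitInj (I : LFun R) [Injective I] :
    tensorToDADL R I ≫ unitInj R I = (tensorCounit R).app I := by
  simp [unitInj]

instance (I : LFun R) [Injective I] : IsIso (unitInj R I) := by
  dsimp only [unitInj]
  infer_instance

lemma unitInj_naturality {I J : LFun R} [Injective I] [Injective J] (v : I ⟶ J) :
    (DADL R).map v ≫ unitInj R J = unitInj R I ≫ v := by
  rw [← cancel_epi (tensorToDADL R I), ← Category.assoc, ← tensorToDADL_naturality, Category.assoc,
    tensorToDADL_unitInj, ← Category.assoc, tensorToDADL_unitInj]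
  exact (tensorCounit R).naturality v

/-- A projective presentation of `op G`, read in the original category. -/
lemma exists_injective_copresentation (G : LFun R) :
    ∃ (I J : LFun R) (j : G ⟶ I) (d : I ⟶ J) (w : j ≫ d = 0), Injective I ∧ Injective J ∧
      (ShortComplex.mk j d w).Exact ∧ Mono j ∧
      ((ShortComplex.mk j d w).op.map (DL R)).Exact ∧ Epi ((DL R).map j.op) := by
  obtain ⟨P₁, P₀, d, p, w, _, _, h₁, _, h₂, h₃⟩ := exists_leftDerived_zero_exact (YevR R) (op G)
  exact ⟨P₀.unop, P₁.unop, p.unop, d.unop, congrArg Quiver.Hom.unop w, inferInstance,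
    inferInstance, h₁.unop, inferInstance, h₂, h₃⟩

/-- The map is induced on the kernel of $I\to J$ by `unitInj`. Any map from $G$ to an injective
factors through $G\to I$, so compatibility with this one embedding gives it for all of them; this
frees the construction from the copresentation and yields naturality. -/
lemma exists_unit (G : LFun R) : ∃ θ : (DADL R).obj G ⟶ G, ∀ (I : LFun R) [Injective I]
    (g : G ⟶ I), θ ≫ g = (DADL R).map g ≫ unitInj R I := by
  obtain ⟨I, J, j, d, w, _, _, h, _, -⟩ := exists_injective_copresentation R G
  have : Mono (ShortComplex.mk j d w).f := ‹Mono j›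
  have h0 : ((DADL R).map j ≫ unitInj R I) ≫ d = 0 := by
    rw [Category.assoc, ← unitInj_naturality, ← (DADL R).map_comp_assoc, w, (DADL R).map_zero,
      zero_comp]
  obtain ⟨θ, hl⟩ : ∃ θ : (DADL R).obj G ⟶ G, θ ≫ j = (DADL R).map j ≫ unitInj R I :=
    ⟨h.lift _ h0, h.lift_f _ h0⟩
  refine ⟨θ, fun I' _ g => ?_⟩
  rw [← Injective.comp_factorThru g j, reassoc_of% hl, (DADL R).map_comp, Category.assoc,
    unitInj_naturality]
  rfl

/-- The morphism `D_A D_L G ⟶ G`. -/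
noncomputable def unitApp (G : LFun R) : (DADL R).obj G ⟶ G := (exists_unit R G).choose

lemma unitApp_comp {G I : LFun R} [Injective I] (g : G ⟶ I) :
    unitApp R G ≫ g = (DADL R).map g ≫ unitInj R I := (exists_unit R G).choose_spec I g

lemma unitApp_naturality {G H : LFun R} (v : G ⟶ H) :
    (DADL R).map v ≫ unitApp R H = unitApp R G ≫ v := by
  rw [← cancel_mono (Injective.ι H), Category.assoc, Category.assoc, unitApp_comp, unitApp_comp,
    (DADL R).map_comp, Category.assoc]

/-- This links the unit to the counit of $t\dashv\mathrm{ev}_R$ for every $G$, which is what later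
identifies $\gamma$ on representables. -/
lemma tensorToDADL_unitApp (G : LFun R) :
    tensorToDADL R G ≫ unitApp R G = (tensorCounit R).app G := by
  rw [← cancel_mono (Injective.ι G), Category.assoc, unitApp_comp, ← Category.assoc,
    ← tensorToDADL_naturality, Category.assoc, tensorToDADL_unitInj]
  exact (tensorCounit R).naturality _

/-- $D_L$ makes the copresentation right exact and $D_A$ makes that left exact, so $D_A D_L G$ is
the kernel of $D_A D_L I\to D_A D_L J$. The inverse `s` is the lift of $G\to I\cong D_A D_L I$ to
this kernel. -/
instance (G : LFun R) : IsIso (unitApp R G) := by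
  obtain ⟨I, J, j, d, w, _, _, h, _, h₁, h₂⟩ := exists_injective_copresentation R G
  have w' : (DL R).map d.op ≫ (DL R).map j.op = 0 := by
    rw [← (DL R).map_comp, ← op_comp, w, op_zero, (DL R).map_zero]
  obtain ⟨h₃, h₄⟩ := DA_exact R (S := ShortComplex.mk _ _ w') h₁ h₂
  have : Mono ((ShortComplex.mk _ _ w').op.map (DA R)).f := h₄
  have h4 : Mono ((DADL R).map j) := h₄
  obtain ⟨s, hs⟩ : ∃ s : G ⟶ (DADL R).obj G, s ≫ (DADL R).map j = j ≫ inv (unitInj R I) := by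
    have h0 : (j ≫ inv (unitInj R I)) ≫ (DADL R).map d = 0 := by
      have := unitInj_naturality R d
      rw [← cancel_mono (unitInj R J), Category.assoc, this]
      simp [w]
    exact ⟨h₃.lift _ h0, h₃.lift_f _ h0⟩
  refine ⟨s, ?_, ?_⟩
  · rw [← cancel_mono ((DADL R).map j), Category.assoc, hs, ← Category.assoc, unitApp_comp]
    simp
  · rw [← cancel_mono j, Category.assoc, unitApp_comp, ← Category.assoc, hs]
    simp

/-! ### The adjunction -/

/-- The map `Nat(D_L G, F) ⟶ Nat(D_A F, G)`. -/
noncomputable def adjHom (G : LFun R) (F : FPFun R) :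
    ((DL R).obj (op G) ⟶ F) →+ ((DA R).obj (op F) ⟶ G) :=
  AddMonoidHom.mk' (fun α => (DA R).map α.op ≫ unitApp R G) fun α β => by
    rw [op_add, (DA R).map_add, Preadditive.add_comp]

variable {R}

lemma adjHom_apply {G : LFun R} {F : FPFun R} (α : (DL R).obj (op G) ⟶ F) :
    adjHom R G F α = (DA R).map α.op ≫ unitApp R G := rfl

lemma adjHom_comp {G : LFun R} {F F' : FPFun R} (α : (DL R).obj (op G) ⟶ F) (u : F ⟶ F') :
    adjHom R G F' (α ≫ u) = (DA R).map u.op ≫ adjHom R G F α := by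
  rw [adjHom_apply, adjHom_apply, op_comp, (DA R).map_comp, Category.assoc]

lemma adjHom_precomp {G G' : LFun R} {F : FPFun R} (α : (DL R).obj (op G) ⟶ F) (v : G ⟶ G') :
    adjHom R G' F ((DL R).map v.op ≫ α) = adjHom R G F α ≫ v := by
  rw [adjHom_apply, adjHom_apply, op_comp, (DA R).map_comp, Category.assoc, Category.assoc,
    ← unitApp_naturality]
  rfl

/-- On morphisms that factor through $D_L G\to(G(R),-)$, `adjHom` is transposition for
$t\dashv\mathrm{ev}_R$. -/
lemma tToDA_adjHom {G : LFun R} {X : RMod R} (f : X ⟶ (evR R).obj G) :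
    tToDA R X ≫ adjHom R G _ (fromDL R G ≫ (yonedaFP R).map f.op) =
      (t R).map f ≫ (tensorCounit R).app G := by
  rw [adjHom_comp, ← tensorToDADL_unitApp, adjHom_apply, ← Category.assoc, ← tToDA_naturality,
    Category.assoc]
  simp only [tensorToDADL, Category.assoc]

/-- Both groups are $\mathrm{Hom}_R(X,I(R))$: one since $D_L I\cong(I(R),-)$ and Yoneda is fully
faithful, the other through $D_A(X,-)\cong X\otimes -$ and the tensor adjunction. -/
lemma adjHom_bijective_of_injective_of_representable (I : LFun R) [Injective I] (X : RMod R) :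
    Function.Bijective (adjHom R I ((yonedaFP R).obj (op X))) := by
  let e₁ : (X ⟶ (evR R).obj I) ≃ ((DL R).obj (op I) ⟶ (yonedaFP R).obj (op X)) :=
    (opEquiv (op ((evR R).obj I)) (op X)).symm.trans ((yonedaFPFullyFaithful R).homEquiv.trans
      (asIso (fromDL R I)).symm.homFromEquiv)
  let e₂ := ((tensorAdj R).homEquiv X I).symm.trans (asIso (tToDA R X)).homFromEquiv
  have h : ∀ f, adjHom R I _ (e₁ f) = e₂ f := fun f => by
    rw [← cancel_epi (tToDA R X)]
    have h₂ : e₂ f = inv (tToDA R X) ≫ (t R).map f ≫ (tensorCounit R).app I :=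
      congrArg (inv (tToDA R X) ≫ ·) ((tensorAdj R).homEquiv_counit X I f)
    rw [h₂, IsIso.hom_inv_id_assoc]
    exact tToDA_adjHom f
  have h' : adjHom R I ((yonedaFP R).obj (op X)) = e₂ ∘ e₁.symm := by
    funext α
    rw [Function.comp_apply, ← h, Equiv.apply_symm_apply]
  rw [h']
  exact e₂.bijective.comp e₁.symm.bijective

/-- With $D_L I$ projective and $I$ injective, $\mathrm{Nat}(D_L I,-)$ and $\mathrm{Nat}(D_A -,I)$
both send the presentation of $F$ to a right exact sequence, and a diagram chase reduces to
representables. -/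
lemma adjHom_bijective_of_injective (I : LFun R) [Injective I] (F : FPFun R) :
    Function.Bijective (adjHom R I F) := by
  obtain ⟨X, Y, f, e, hf⟩ := F.exists_presents
  obtain ⟨w, hw, he⟩ := hf.exact
  obtain ⟨h₁, h₂⟩ := DA_exact R hw he
  have hX := adjHom_bijective_of_injective_of_representable I X
  have hY := adjHom_bijective_of_injective_of_representable I Y
  have : Projective ((DL R).obj (op I)) := Projective.of_iso (asIso (fromDL R I)).symm inferInstance
  have : Mono ((DA R).map (F.ofElem e).op) := h₂
  constructor
  · rw [injective_iff_map_eq_zero]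
    intro α hα
    obtain ⟨α', rfl⟩ : ∃ α', α' ≫ F.ofElem e = α := ⟨_, Projective.factorThru_comp α (F.ofElem e)⟩
    rw [adjHom_comp] at hα
    have hβ : (DA R).map ((yonedaFP R).map f.op).op ≫ h₁.descToInjective _ hα = adjHom R I _ α' :=
      h₁.comp_descToInjective _ hα
    obtain ⟨β', hβ'⟩ := hY.2 (h₁.descToInjective _ hα)
    rw [← hβ', ← adjHom_comp] at hβ
    rw [← hX.1 hβ, Category.assoc, w, comp_zero]
  · intro β
    obtain ⟨α, hα⟩ := hX.2 (Injective.factorThru β ((DA R).map (F.ofElem e).op))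
    exact ⟨α ≫ F.ofElem e, by rw [adjHom_comp, hα, Injective.comp_factorThru]⟩

/-- $\mathrm{Nat}(D_L -,F)$ and $\mathrm{Nat}(D_A F,-)$ both send an injective copresentation of $G$
to a left exact sequence, so the injective case suffices. -/
lemma adjHom_bijective (G : LFun R) (F : FPFun R) : Function.Bijective (adjHom R G F) := by
  obtain ⟨I, J, j, d, w, _, _, h, _, h₁, h₂⟩ := exists_injective_copresentation R G
  have hI := adjHom_bijective_of_injective I F
  have hJ := adjHom_bijective_of_injective J F
  constructor
  · rw [injective_iff_map_eq_zero]
    intro α hα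
    rw [← cancel_epi ((DL R).map j.op), comp_zero]
    apply hI.1
    rw [adjHom_precomp, hα, zero_comp, map_zero]
  · intro β
    obtain ⟨α', hα'⟩ := hI.2 (β ≫ j)
    have h0 : (DL R).map d.op ≫ α' = 0 := by
      apply hJ.1
      rw [adjHom_precomp, hα', Category.assoc, w, comp_zero, map_zero]
    have : Epi ((ShortComplex.mk j d w).op.map (DL R)).g := h₂
    obtain ⟨α, hα⟩ : ∃ α, (DL R).map j.op ≫ α = α' := ⟨h₁.desc α' h0, h₁.g_desc α' h0⟩
    refine ⟨α, ?_⟩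
    rw [← cancel_mono j, ← adjHom_precomp, hα, hα']

variable (R)

/-- The additive bijections `Nat(D_L G, F) ≃ Nat(D_A F, G)`. -/
noncomputable def adjEquiv (G : LFun R) (F : FPFun R) :
    ((DL R).obj (op G) ⟶ F) ≃+ ((DA R).obj (op F) ⟶ G) :=
  AddEquiv.ofBijective (adjHom R G F) (adjHom_bijective G F)

/-- `D_L` is left adjoint to `D_A`. -/
noncomputable def adj : DL R ⊣ (DA R).rightOp :=
  Adjunction.mkOfHomEquiv
    { homEquiv := fun G F => (adjEquiv R G.unop F).toEquiv.trans (opEquiv _ _).symm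
      homEquiv_naturality_left_symm := fun {G' G F} f g => by
        rw [Equiv.symm_apply_eq]
        let α := ((adjEquiv R G.unop F).toEquiv.trans (opEquiv G (op ((DA R).obj (op F)))).symm).symm g
        have hα : (adjHom R G.unop F α).op = g := Equiv.apply_symm_apply
          ((adjEquiv R G.unop F).toEquiv.trans (opEquiv G (op ((DA R).obj (op F)))).symm) g
        exact (congrArg (f ≫ ·) hα.symm).trans
          (congrArg Quiver.Hom.op (adjHom_precomp α f.unop)).symm
      homEquiv_naturality_right := fun {G F F'} α u =>
        congrArg Quiver.Hom.op (adjHom_comp α u) }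

lemma adj_homEquiv (G : LFun R) (F : FPFun R) (α : (DL R).obj (op G) ⟶ F) :
    (adj R).homEquiv (op G) F α = (adjHom R G F α).op := by
  simp [adj]
  rfl

instance : IsIso (adj R).unit := by
  have : ∀ G : (LFun R)ᵒᵖ, IsIso ((adj R).unit.app G) := fun G => by
    have h : (adj R).unit.app G = (unitApp R G.unop).op := by
      rw [← Adjunction.homEquiv_id]
      refine (adj_homEquiv R G.unop _ (𝟙 _)).trans ?_
      rw [adjHom_apply, op_id, (DA R).map_id, Category.id_comp]
    rw [h]
    infer_instance
  exact NatIso.isIso_of_isIso_app _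

/-- The counit is the morphism whose transpose is the identity. Transposing `gammaRep` reduces,
through `tToDA_adjHom`, to a triangle identity of $t\dashv\mathrm{ev}_R$. -/
lemma adj_counit_app (X : RMod R) :
    (adj R).counit.app ((yonedaFP R).obj (op X)) = gammaRep R X := by
  rw [← Adjunction.homEquiv_symm_id, Equiv.symm_apply_eq]
  refine Eq.trans ?_ (adj_homEquiv R _ _ (gammaRep R X)).symm
  refine congrArg Quiver.Hom.op (Eq.symm ?_ :
    𝟙 ((DA R).obj (op ((yonedaFP R).obj (op X)))) = adjHom R _ _ (gammaRep R X))
  refine (adjHom_precomp (fromDL R ((t R).obj X) ≫ (yonedaFP R).map (toEvT R X).op)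
    (tToDA R X)).trans ?_
  rw [← cancel_epi (tToDA R X), ← Category.assoc, tToDA_adjHom, Category.comp_id]
  exact ((tensorAdj R).left_triangle_components X =≫ tToDA R X).trans (Category.id_comp _)

end AGJ

/-! ### The Left Adjoint Theorem. -/

theorem mainTheorem1 (R : Type u) [Ring R] :
    (PreservesFiniteLimits (AGJ.DA R) ∧ PreservesFiniteColimits (AGJ.DA R)) ∧
    ((AGJ.DL R).Full ∧ (AGJ.DL R).Faithful) ∧
    ∃ γ : (AGJ.DA R).rightOp ⋙ AGJ.DL R ⟶ 𝟭 (AGJ.FPFun R),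
      (∀ X : AGJ.RMod R, γ.app ((AGJ.yonedaFP R).obj (op X)) = AGJ.gammaRep R X) ∧
      (∀ γ' : (AGJ.DA R).rightOp ⋙ AGJ.DL R ⟶ 𝟭 (AGJ.FPFun R),
        (∀ X : AGJ.RMod R, γ'.app ((AGJ.yonedaFP R).obj (op X)) = AGJ.gammaRep R X) → γ' = γ) ∧
      ∃ adj : AGJ.DL R ⊣ (AGJ.DA R).rightOp,
        adj.counit = γ ∧ IsIso adj.unit ∧
        ∃ e : ∀ (G : AGJ.LFun R) (F : AGJ.FPFun R),
            ((AGJ.DL R).obj (op G) ⟶ F) ≃+ ((AGJ.DA R).obj (op F) ⟶ G),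
          (∀ G F (α : (AGJ.DL R).obj (op G) ⟶ F),
            e G F α = (adj.homEquiv (op G) F α).unop) ∧
          (∀ G F F' (α : (AGJ.DL R).obj (op G) ⟶ F) (u : F ⟶ F'),
            e G F' (α ≫ u) = (AGJ.DA R).map u.op ≫ e G F α) ∧
          (∀ G G' F (α : (AGJ.DL R).obj (op G) ⟶ F) (v : G ⟶ G'),
            e G' F ((AGJ.DL R).map v.op ≫ α) = e G F α ≫ v) := by
  refine ⟨⟨inferInstance, inferInstance⟩,
    ⟨(AGJ.adj R).fullyFaithfulLOfIsIsoUnit.full, (AGJ.adj R).fullyFaithfulLOfIsIsoUnit.faithful⟩,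
    (AGJ.adj R).counit, AGJ.adj_counit_app R, fun γ' h => ?_, AGJ.adj R, rfl, inferInstance,
    AGJ.adjEquiv R, fun G F α => ?_, fun G F F' α u => AGJ.adjHom_comp α u,
    fun G G' F α v => AGJ.adjHom_precomp α v⟩
  -- Uniqueness: a representable $(X,-)$ covers $F$. The map $D_A F\to D_A(X,-)$ is mono, hence epi
  -- in the opposite category, and the left adjoint $D_L$ keeps it epi; naturality then determines
  -- the component at $F$ from the one at $(X,-)$.
  · ext F : 2
    obtain ⟨X, Y, f, e, hf⟩ := F.exists_presents
    obtain ⟨w, hw, he⟩ := hf.exact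
    have : Epi ((AGJ.DA R).rightOp.map (F.ofElem e)) := by
      have := hf.mono_DA R
      exact inferInstanceAs (Epi ((AGJ.DA R).map (F.ofElem e).op).op)
    have : (AGJ.DL R).PreservesEpimorphisms :=
      Functor.preservesEpimorphisms_of_adjunction (AGJ.adj R)
    have : Epi (((AGJ.DA R).rightOp ⋙ AGJ.DL R).map (F.ofElem e)) :=
      inferInstanceAs (Epi ((AGJ.DL R).map ((AGJ.DA R).rightOp.map (F.ofElem e))))
    rw [← cancel_epi (((AGJ.DA R).rightOp ⋙ AGJ.DL R).map (F.ofElem e)), γ'.naturality,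
      (AGJ.adj R).counit.naturality, h, AGJ.adj_counit_app]
  · rw [AGJ.adj_homEquiv]
    rfl
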